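/- Let $a<b$, let $n_1,n_2,n_3,n_z,n_{bc},K\ge 0$ be integers, let $\tau_1,\dots,\tau_K>0$, and let $U=L_2^{n_1}\times H_1^{n_2}\times H_2^{n_3}$ on $[a,b]$. For $\mathbf u=(u_1,u_2,u_3)\in U$ put $\mathscr D_{\rm int}\mathbf u=(u_1,u_2,u_3,\partial_xu_2,\partial_xu_3,\partial_x^2u_3)$, let $\Lambda_{\rm bf}\mathbf u$ be the vector of the values of $u_2,u_3,\partial_xu_3$ at $x=a$ and $x=b$, and let $\mathscr D\mathbf u=(u_1,\partial_xu_2,\partial_x^2u_3)\in L_2^{n_1+n_2+n_3}[a,b]$. Boundary conditions with parameters $G_{bc}=\{E_p,E_b,E_z\}$ ($E_p$ a matrix function with entries in $L_2[a,b]$; $E_b,E_z$ real matrices) are $BC(\mathbf u,z)=0$, where $$BC(\mathbf u,z)=\int_a^bE_p(x)\,(\mathscr D_{\rm int}\mathbf u)(x)\,dx+E_b\Lambda_{\rm bf}\mathbf u+E_zz\in\mathbb R^{n_{bc}},\qquad z\in\mathbb R^{n_z}.$$ They are well-posed if $BC(\cdot,0)$, restricted to $\ker\mathscr D$ and written in the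 coordinates $(u_2(a),u_3(a),\partial_xu_3(a))\in\mathbb R^{n_2+2n_3}$, is given by an invertible matrix (in particular $n_{bc}=n_2+2n_3$). In that case, for all $\mathbf v\in L_2^{n_1+n_2+n_3}[a,b]$ and $z\in\mathbb R^{n_z}$ there is exactly one $\mathbf u\in U$ with $\mathscr D\mathbf u=\mathbf v$ and $BC(\mathbf u,z)=0$; it is $\mathbf u=\mathcal T\mathbf v+\mathcal T_zz$ with bounded linear operators $\mathcal T,\mathcal T_z$. Put $\mathcal T_{\rm int}=\mathscr D_{\rm int}\mathcal T$, $\mathcal T_{{\rm int},z}=\mathscr D_{\rm int}\mathcal T_z$, $\mathcal T_{\rm bf}=\Lambda_{\rm bf}\mathcal T$, $\mathcal T_{{\rm bf},z}=\Lambda_{\rm bf}\mathcal T_z$. For $\psi=(\psi_u,\psi_z)\in L_2^{n_1+n_2+n_3}([0,1]\times[a,b])\times L_2^{n_z}([0,1])$ and $j\in\{1,\dots,K\}$ define $$(\bar{\mathcal T}_{v,j}\psi)(s)=\int_0^s\begin{bmatrix}\mathcal T\psi_u(\theta)+\mathcal T_z\psi_z(\theta)\\ \psi_z(\theta)\end{bmatrix}d\theta,\qquad(\bar{\mathcal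 A}_{v,j}\psi)(s)=-\frac1{\tau_j}\begin{bmatrix}\mathcal T\psi_u(s)+\mathcal T_z\psi_z(s)\\ \psi_z(s)\end{bmatrix},$$ $$\bar{\mathcal C}_{r,j}\psi=\int_0^1\begin{bmatrix}\mathcal T_{\rm int}\psi_u(s)+\mathcal T_{{\rm int},z}\psi_z(s)\\ \mathcal T_{\rm bf}\psi_u(s)+\mathcal T_{{\rm bf},z}\psi_z(s)\\ \psi_z(s)\end{bmatrix}ds,$$ and let $T_q(\mathscr D_{\rm int}\mathbf u,\Lambda_{\rm bf}\mathbf u,z)=(\mathbf u,z)$, a function of $s\in[0,1]$ that is constant in $s$. Let $V=H_1([0,1];U)$, that is, the functions of $(s,x)\in[0,1]\times[a,b]$ with $n_1,n_2,n_3$ components for which $\partial_x^\alpha\partial_s^\beta\varphi\in L_2$ for $\beta\le1$ and $\alpha\le0$, $\alpha\le1$, $\alpha\le2$, respectively. For $q=(\mathscr D_{\rm int}\mathbf u,\Lambda_{\rm bf}\mathbf u,z)$ put $$\mathbf Y_q=\{(\phi_u,\phi_z)\in V\times H_1^{n_z}[0,1]:\ \phi(0)=(\mathbf u,z),\ BC(\phi_u(s),\phi_z(s))=0\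 \text{for all } s\in[0,1]\}.$$ Assume that $G_{bc}$ is well-posed. Let $q(t)=(\mathscr D_{\rm int}q_u(t),\Lambda_{\rm bf}q_u(t),q_z(t))$, $t\ge0$, be an input with $q_u(t)\in U$, $q_z(t)\in\mathbb R^{n_z}$ and $BC(q_u(0),q_z(0))=0$. Then for every $j\in\{1,\dots,K\}$ and every $\psi_0\in L_2^{n_1+n_2+n_3}([0,1]\times[a,b])\times L_2^{n_z}([0,1])$ the function $\phi_0=\bar{\mathcal T}_{v,j}\psi_0+T_qq(0)$ belongs to $\mathbf Y_{q(0)}$, and for all $\psi$ with values in $L_2^{n_1+n_2+n_3}([0,1]\times[a,b])\times L_2^{n_z}([0,1])$ and all $r$ the following are equivalent, where $\phi=\bar{\mathcal T}_{v,j}\psi+T_qq$: 1. $(\psi,r)$ is a solution to the PIE defined by $\{\bar{\mathcal T}_{v,j},T_q,\bar{\mathcal A}_{v,j},0,\bar{\mathcal C}_{r,j},I\}$ with input $q$ and initial condition $\psi_0$: $\psi$ and $q$ are differentiable on $[0,\infty)$ (in the $L_2$ norms, and the Euclidean norms of the finite-dimensional components), $\psi(0)=\psi_0$, and for all $t\ge0$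 $$T_q\,\partial_tq(t)+\bar{\mathcal T}_{v,j}\,\partial_t\psi(t)=\bar{\mathcal A}_{v,j}\psi(t),\qquad r(t)=\bar{\mathcal C}_{r,j}\psi(t)+q(t).$$ 2. $(\phi,r)$ is a solution to the $j$th transport equation with input $q$ and initial condition $\phi_0$: $\phi$ is differentiable on $[0,\infty)$ in the Sobolev norm of $V\times H_1^{n_z}[0,1]$, $\phi(0)=\phi_0$, and for all $t\ge0$ $$\phi(t)\in\mathbf Y_{q(t)},\qquad\partial_t\phi(t,s)=-\frac1{\tau_j}\,\partial_s\phi(t,s),\qquad r(t)=\bigl(\mathscr D_{\rm int}\phi_u(t,1),\ \Lambda_{\rm bf}\phi_u(t,1),\ \phi_z(t,1)\bigr).$$ -/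

import Mathlib

noncomputable section

namespace DelayPIE

open MeasureTheory Set
open scoped ContDiff

/-- Lebesgue measure on the interval `[a, b]`. -/
abbrev leb (a b : ℝ) : Measure ℝ := volume.restrict (Icc a b)

/-- The space `L₂([a, b]; X)` of square-integrable functions with values in `X`. -/
abbrev L2 (a b : ℝ) (X : Type*) [NormedAddCommGroup X] := Lp X 2 (leb a b)

section Calculus

variable {a b : ℝ} {X : Type*} [NormedAddCommGroup X]

theorem l2_integrable (f : L2 a b X) : Integrable f (leb a b) :=
  (Lp.memLp f).integrable (by norm_num)

theorem l2_integral_norm_le (f : L2 a b X) :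
    ∫ t, ‖f t‖ ∂(leb a b) ≤ (leb a b).real univ ^ (1 / 2 : ℝ) * ‖f‖ := by
  have h1 := eLpNorm_le_eLpNorm_mul_rpow_measure_univ (μ := leb a b) (p := 1) (q := 2)
    (by norm_num) (Lp.aestronglyMeasurable f)
  rw [integral_norm_eq_lintegral_enorm (Lp.aestronglyMeasurable f), Lp.norm_def,
    ← eLpNorm_one_eq_lintegral_enorm, mul_comm]
  refine (ENNReal.toReal_mono ?_ h1).trans (le_of_eq ?_)
  · refine ENNReal.mul_ne_top (Lp.eLpNorm_ne_top f) (ENNReal.rpow_ne_top_of_nonneg ?_ ?_)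
    · norm_num
    · exact measure_ne_top _ _
  · rw [ENNReal.toReal_mul, ← ENNReal.toReal_rpow, Measure.real]
    norm_num

variable [NormedSpace ℝ X]

/-- `∫_a^x f(t) dt` (for `x ∈ [a, b]`), as a continuous linear functional of `f ∈ L₂([a, b]; X)`. -/
def intTo (a b : ℝ) (X : Type*) [NormedAddCommGroup X] [NormedSpace ℝ X] (x : ℝ) :
    L2 a b X →L[ℝ] X :=
  LinearMap.mkContinuous
    { toFun := fun f => ∫ t in Iic x, f t ∂(leb a b)
      map_add' := fun f g => by
        rw [← integral_add (l2_integrable f).integrableOn (l2_integrable g).integrableOn]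
        refine integral_congr_ae (ae_restrict_of_ae ?_)
        filter_upwards [Lp.coeFn_add f g] with t ht
        simpa using ht
      map_smul' := fun c f => by
        rw [RingHom.id_apply, ← integral_smul]
        refine integral_congr_ae (ae_restrict_of_ae ?_)
        filter_upwards [Lp.coeFn_smul c f] with t ht
        simpa using ht }
    ((leb a b).real univ ^ (1 / 2 : ℝ)) fun f => by
      refine (norm_integral_le_integral_norm _).trans ((setIntegral_le_integral (l2_integrable f).norm
        (Filter.Eventually.of_forall fun _ => norm_nonneg _)).trans (l2_integral_norm_le f))

theorem intTo_apply (x : ℝ) (f : L2 a b X) :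
    intTo a b X x f = ∫ t in Iic x, f t ∂(leb a b) := rfl

theorem intTo_eq_intervalIntegral {x : ℝ} (hx : x ∈ Icc a b) (f : L2 a b X) :
    intTo a b X x f = ∫ t in a..x, f t := by
  rw [intTo_apply, Measure.restrict_restrict measurableSet_Iic, inter_comm, show Icc a b ∩ Iic x = Icc a x from by
      ext t; simp only [mem_inter_iff, mem_Icc, mem_Iic]; constructor
      · rintro ⟨⟨h1, _⟩, h3⟩; exact ⟨h1, h3⟩
      · rintro ⟨h1, h3⟩; exact ⟨⟨h1, h3.trans hx.2⟩, h3⟩,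
    integral_Icc_eq_integral_Ioc, intervalIntegral.integral_of_le hx.1]

theorem norm_intTo_le (x : ℝ) (f : L2 a b X) :
    ‖intTo a b X x f‖ ≤ (leb a b).real univ ^ (1 / 2 : ℝ) * ‖f‖ :=
  LinearMap.mkContinuous_norm_le _ (by positivity) _ |> fun h =>
    (ContinuousLinearMap.le_opNorm _ _).trans (mul_le_mul_of_nonneg_right h (norm_nonneg _))

theorem continuous_intTo (f : L2 a b X) : Continuous fun x => intTo a b X x f := by
  have h : (fun x => intTo a b X x f)
      = fun x => (∫ t in Iic a, f t ∂(leb a b)) + ∫ t in a..x, f t ∂(leb a b) := by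
    funext x
    rw [← intervalIntegral.integral_Iic_sub_Iic (l2_integrable f).integrableOn
      (l2_integrable f).integrableOn, intTo_apply]
    abel
  rw [h]
  exact continuous_const.add (intervalIntegral.continuous_primitive
    (fun _ _ => (l2_integrable f).intervalIntegrable) a)

theorem memLp_intTo (f : L2 a b X) : MemLp (fun x => intTo a b X x f) 2 (leb a b) :=
  MemLp.of_bound (continuous_intTo f).aestronglyMeasurable _
    (Filter.Eventually.of_forall fun x => norm_intTo_le x f)

/-- `x ↦ ∫_a^x f(t) dt` as a bounded operator on `L₂([a, b]; X)`. -/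
def prim (a b : ℝ) (X : Type*) [NormedAddCommGroup X] [NormedSpace ℝ X] :
    L2 a b X →L[ℝ] L2 a b X :=
  LinearMap.mkContinuous
    { toFun := fun f => (memLp_intTo f).toLp _
      map_add' := fun f g => by
        rw [← MemLp.toLp_add]
        congr 1
        funext x
        simp
      map_smul' := fun c f => by
        rw [RingHom.id_apply, ← MemLp.toLp_const_smul]
        congr 1
        funext x
        simp }
    ((measureUnivNNReal (leb a b) : ℝ) ^ (ENNReal.toReal 2)⁻¹ *
      (leb a b).real univ ^ (1 / 2 : ℝ)) fun f => by
      have h := Lp.norm_le_of_ae_bound (p := 2) (μ := leb a b) (f := (memLp_intTo f).toLp _)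
        (C := (leb a b).real univ ^ (1 / 2 : ℝ) * ‖f‖) (by positivity) (by
          filter_upwards [(memLp_intTo f).coeFn_toLp] with x hx
          rw [hx]
          exact norm_intTo_le x f)
      rw [mul_assoc]
      exact h

theorem coeFn_prim (f : L2 a b X) : prim a b X f =ᵐ[leb a b] fun x => intTo a b X x f :=
  (memLp_intTo f).coeFn_toLp

/-- The constant function with value `c`, as an element of `L₂([a, b]; X)`. -/
def constL (a b : ℝ) (X : Type*) [NormedAddCommGroup X] [NormedSpace ℝ X] : X →L[ℝ] L2 a b X :=
  Lp.constL 2 (leb a b) ℝ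

/-- `g` is the weak derivative of `f` on `(a, b)`. -/
def IsWeakDeriv (f g : L2 a b X) : Prop :=
  ∀ η : ℝ → ℝ, ContDiff ℝ ∞ η → HasCompactSupport η → tsupport η ⊆ Ioo a b →
    ∫ x, deriv η x • f x ∂(leb a b) = -∫ x, η x • g x ∂(leb a b)

theorem integrable_smul {η : ℝ → ℝ} (hη : Continuous η) (hc : HasCompactSupport η)
    (f : L2 a b X) : Integrable (fun x => η x • f x) (leb a b) := by
  obtain ⟨C, hC⟩ := hc.exists_bound_of_continuous hη
  exact (l2_integrable f).bdd_smul C hη.aestronglyMeasurable (Filter.Eventually.of_forall hC)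

theorem isWeakDeriv_prim [CompleteSpace X] (f : L2 a b X) : IsWeakDeriv (prim a b X f) f := by
  intro η hη hc hs
  have hη' : Continuous (deriv η) := hη.continuous_deriv (by simp)
  have hb : η b = 0 := by
    by_contra h
    exact lt_irrefl b (hs (subset_tsupport _ h)).2
  obtain ⟨C, hC⟩ := hc.deriv.exists_bound_of_continuous hη'
  have hint : Integrable (deriv η) (leb a b) :=
    Integrable.of_bound hη'.aestronglyMeasurable C (Filter.Eventually.of_forall hC)
  have hprod : Integrable (fun p : ℝ × ℝ =>
      {q : ℝ × ℝ | q.2 ≤ q.1}.indicator (fun q => deriv η q.1 • f q.2) p)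
      ((leb a b).prod (leb a b)) :=
    (hint.smul_prod (l2_integrable f)).indicator (measurableSet_le measurable_snd measurable_fst)
  calc ∫ x, deriv η x • prim a b X f x ∂(leb a b)
      = ∫ x, ∫ t, {q : ℝ × ℝ | q.2 ≤ q.1}.indicator (fun q => deriv η q.1 • f q.2) (x, t)
          ∂(leb a b) ∂(leb a b) := by
        refine integral_congr_ae ?_
        filter_upwards [coeFn_prim f] with x hx
        rw [hx, intTo_apply, ← integral_indicator measurableSet_Iic, ← integral_smul]
        refine integral_congr_ae (Filter.Eventually.of_forall fun t => ?_)
        by_cases h : t ≤ x <;> simp [indicator, h]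
    _ = ∫ t, ∫ x, {q : ℝ × ℝ | q.2 ≤ q.1}.indicator (fun q => deriv η q.1 • f q.2) (x, t)
          ∂(leb a b) ∂(leb a b) := integral_integral_swap hprod
    _ = ∫ t, -(η t • f t) ∂(leb a b) := by
        refine setIntegral_congr_fun measurableSet_Icc fun t ht => ?_
        have h1 : ∀ x, {q : ℝ × ℝ | q.2 ≤ q.1}.indicator (fun q => deriv η q.1 • f q.2) (x, t)
            = (Ici t).indicator (fun x => deriv η x • f t) x := by
          intro x
          by_cases h : t ≤ x <;> simp [indicator, h]
        simp only [h1]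
        rw [integral_indicator measurableSet_Ici, Measure.restrict_restrict measurableSet_Ici,
          show Ici t ∩ Icc a b = Icc t b from by
            ext x; simp only [mem_inter_iff, mem_Icc, mem_Ici]; constructor
            · rintro ⟨h1, _, h3⟩; exact ⟨h1, h3⟩
            · rintro ⟨h1, h3⟩; exact ⟨h1, ht.1.trans h1, h3⟩,
          integral_smul_const, integral_Icc_eq_integral_Ioc,
          ← intervalIntegral.integral_of_le ht.2,
          intervalIntegral.integral_deriv_eq_sub
            (fun x _ => (hη.differentiable (by simp)).differentiableAt)
            (hη'.intervalIntegrable _ _), hb, zero_sub, neg_smul]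
    _ = -∫ x, η x • f x ∂(leb a b) := integral_neg _

theorem IsWeakDeriv.add {f g f' g' : L2 a b X} (h : IsWeakDeriv f f') (k : IsWeakDeriv g g') :
    IsWeakDeriv (f + g) (f' + g') := by
  intro η hη hc hs
  have hη' : Continuous (deriv η) := hη.continuous_deriv (by simp)
  have e1 : ∫ x, deriv η x • (f + g : L2 a b X) x ∂(leb a b)
      = ∫ x, (deriv η x • f x + deriv η x • g x) ∂(leb a b) := by
    refine integral_congr_ae ?_
    filter_upwards [Lp.coeFn_add f g] with x hx
    rw [hx, Pi.add_apply, smul_add]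
  have e2 : ∫ x, η x • (f' + g' : L2 a b X) x ∂(leb a b)
      = ∫ x, (η x • f' x + η x • g' x) ∂(leb a b) := by
    refine integral_congr_ae ?_
    filter_upwards [Lp.coeFn_add f' g'] with x hx
    rw [hx, Pi.add_apply, smul_add]
  rw [e1, e2, integral_add (integrable_smul hη' hc.deriv f) (integrable_smul hη' hc.deriv g),
    integral_add (integrable_smul hη.continuous hc f') (integrable_smul hη.continuous hc g'),
    h η hη hc hs, k η hη hc hs, neg_add]

theorem IsWeakDeriv.smul (c : ℝ) {f f' : L2 a b X} (h : IsWeakDeriv f f') :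
    IsWeakDeriv (c • f) (c • f') := by
  intro η hη hc hs
  have e1 : ∫ x, deriv η x • (c • f : L2 a b X) x ∂(leb a b)
      = ∫ x, c • (deriv η x • f x) ∂(leb a b) := by
    refine integral_congr_ae ?_
    filter_upwards [Lp.coeFn_smul c f] with x hx
    rw [hx, Pi.smul_apply, smul_comm]
  have e2 : ∫ x, η x • (c • f' : L2 a b X) x ∂(leb a b)
      = ∫ x, c • (η x • f' x) ∂(leb a b) := by
    refine integral_congr_ae ?_
    filter_upwards [Lp.coeFn_smul c f'] with x hx
    rw [hx, Pi.smul_apply, smul_comm]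
  rw [e1, e2, integral_smul, integral_smul, h η hη hc hs, smul_neg]

theorem IsWeakDeriv.zero : IsWeakDeriv (0 : L2 a b X) 0 := by
  intro η _ _ _
  have e : ∀ ζ : ℝ → ℝ, ∫ x, ζ x • (0 : L2 a b X) x ∂(leb a b) = 0 := by
    intro ζ
    refine integral_eq_zero_of_ae ?_
    filter_upwards [Lp.coeFn_zero X 2 (leb a b)] with x hx
    rw [hx]
    simp
  rw [e, e, neg_zero]

theorem coeFn_constL (c : X) : constL a b X c =ᵐ[leb a b] fun _ => c :=
  Lp.coeFn_const 2 (leb a b) c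

theorem integral_deriv_eq_zero {η : ℝ → ℝ} (hη : ContDiff ℝ ∞ η) (hs : tsupport η ⊆ Ioo a b) :
    ∫ x, deriv η x ∂(leb a b) = 0 := by
  rcases le_or_gt a b with hab | hab
  · have h0 : ∀ x, x ∉ Ioo a b → η x = 0 := fun x hx => by
      by_contra h
      exact hx (hs (subset_tsupport _ h))
    rw [integral_Icc_eq_integral_Ioc, ← intervalIntegral.integral_of_le hab,
      intervalIntegral.integral_deriv_eq_sub
        (fun x _ => (hη.differentiable (by simp)).differentiableAt)
        ((hη.continuous_deriv (by simp)).intervalIntegrable _ _),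
      h0 a (by simp), h0 b (by simp), sub_zero]
  · simp [leb, Icc_eq_empty_of_lt hab]

theorem isWeakDeriv_constL [CompleteSpace X] (c : X) :
    IsWeakDeriv (constL a b X c) (0 : L2 a b X) := by
  intro η hη hc hs
  have e1 : ∫ x, deriv η x • constL a b X c x ∂(leb a b) = ∫ x, deriv η x • c ∂(leb a b) := by
    refine integral_congr_ae ?_
    filter_upwards [coeFn_constL (a := a) (b := b) c] with x hx
    rw [hx]
  have e2 : ∫ x, η x • (0 : L2 a b X) x ∂(leb a b) = 0 := by
    refine integral_eq_zero_of_ae ?_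
    filter_upwards [Lp.coeFn_zero X 2 (leb a b)] with x hx
    rw [hx]
    simp
  rw [e1, e2, integral_smul_const, integral_deriv_eq_zero hη hs, zero_smul, neg_zero]

theorem IsWeakDeriv.exists_const [CompleteSpace X] (hab : a < b) {h : L2 a b X}
    (H : IsWeakDeriv h 0) : ∃ c : X, h =ᵐ[leb a b] fun _ => c := by
  -- a normalized bump function
  let β : ContDiffBump ((a + b) / 2) := ⟨(b - a) / 8, (b - a) / 4, by linarith, by linarith⟩
  let η₀ : ℝ → ℝ := β.normed volume
  have hη₀ : ContDiff ℝ ∞ η₀ := β.contDiff_normed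
  have hc₀ : HasCompactSupport η₀ := β.hasCompactSupport_normed
  have hs₀ : tsupport η₀ ⊆ Ioo a b := by
    rw [show tsupport η₀ = _ from β.tsupport_normed_eq, Real.closedBall_eq_Icc]
    intro x hx
    have h1 : (a + b) / 2 - (b - a) / 4 ≤ x := hx.1
    have h2 : x ≤ (a + b) / 2 + (b - a) / 4 := hx.2
    constructor <;> linarith
  have hi₀ : ∫ x, η₀ x ∂(leb a b) = 1 := by
    rw [setIntegral_eq_integral_of_forall_compl_eq_zero]
    · exact β.integral_normed
    · intro x hx
      by_contra h
      exact hx (Ioo_subset_Icc_self (hs₀ (subset_tsupport _ h)))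
  have hz : ∀ ζ : ℝ → ℝ, ∫ x, ζ x • (0 : L2 a b X) x ∂(leb a b) = 0 := by
    intro ζ
    refine integral_eq_zero_of_ae ?_
    filter_upwards [Lp.coeFn_zero X 2 (leb a b)] with x hx
    rw [hx]
    simp
  -- test functions of mean zero are derivatives of test functions
  have key : ∀ ζ : ℝ → ℝ, ContDiff ℝ ∞ ζ → HasCompactSupport ζ → tsupport ζ ⊆ Ioo a b →
      ∫ x, ζ x ∂(leb a b) = 0 → ∫ x, ζ x • h x ∂(leb a b) = 0 := by
    intro ζ hζ hc hs h0
    let K : Set ℝ := insert ((a + b) / 2) (tsupport ζ)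
    have hK : IsCompact K := hc.insert _
    have hKne : K.Nonempty := ⟨_, mem_insert _ _⟩
    have hKs : K ⊆ Ioo a b := by
      rintro x (rfl | hx)
      · constructor <;> linarith
      · exact hs hx
    set l := sInf K
    set r := sSup K
    have hl : l ∈ K := hK.sInf_mem hKne
    have hr : r ∈ K := hK.sSup_mem hKne
    have hlr : ∀ x ∈ K, l ≤ x ∧ x ≤ r := fun x hx =>
      ⟨csInf_le hK.bddBelow hx, le_csSup hK.bddAbove hx⟩
    have hζ0 : ∀ x, x ∉ K → ζ x = 0 := fun x hx => by
      by_contra h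
      exact hx (mem_insert_of_mem _ (subset_tsupport _ h))
    have hζi : ∀ x y, IntervalIntegrable ζ volume x y := fun x y =>
      hζ.continuous.intervalIntegrable _ _
    let η : ℝ → ℝ := fun x => ∫ t in a..x, ζ t
    have hd : ∀ x, HasDerivAt η (ζ x) x := fun x =>
      intervalIntegral.integral_hasDerivAt_right (hζi _ _)
        (hζ.continuous.stronglyMeasurableAtFilter _ _) hζ.continuous.continuousAt
    have hde : deriv η = ζ := funext fun x => (hd x).deriv
    have hη : ContDiff ℝ ∞ η := by
      rw [contDiff_infty_iff_deriv]
      exact ⟨fun x => (hd x).differentiableAt, hde ▸ hζ⟩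
    have htot : ∫ t in a..b, ζ t = 0 := by
      rw [intervalIntegral.integral_of_le hab.le, ← integral_Icc_eq_integral_Ioc]
      exact h0
    have hsub : Function.support η ⊆ Icc l r := by
      intro x hx
      by_contra hxn
      apply hx
      rw [mem_Icc, not_and_or, not_le, not_le] at hxn
      rcases hxn with hxl | hxr
      · refine intervalIntegral.integral_zero_ae (Filter.Eventually.of_forall fun t ht => ?_)
        apply hζ0
        intro htK
        have h1 := (hlr t htK).1
        have h2 := ht.2
        have h3 : a < l := (hKs hl).1
        rcases le_total a x with hax | hax
        · rw [max_eq_right hax] at h2; linarith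
        · rw [max_eq_left hax] at h2; linarith
      · have e : η x = (∫ t in a..b, ζ t) + ∫ t in b..x, ζ t :=
          (intervalIntegral.integral_add_adjacent_intervals (hζi _ _) (hζi _ _)).symm
        rw [e, htot, zero_add]
        refine intervalIntegral.integral_zero_ae (Filter.Eventually.of_forall fun t ht => ?_)
        apply hζ0
        intro htK
        have h1 := (hlr t htK).2
        have h2 := ht.1
        have h3 : r < b := (hKs hr).2
        rcases le_total b x with hax | hax
        · rw [min_eq_left hax] at h2; linarith
        · rw [min_eq_right hax] at h2; linarith
    have hts : tsupport η ⊆ Icc l r := closure_minimal hsub isClosed_Icc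
    have hcs : HasCompactSupport η := isCompact_Icc.of_isClosed_subset (isClosed_tsupport _) hts
    have := H η hη hcs fun x hx =>
      ⟨(hKs hl).1.trans_le (hts hx).1, (hts hx).2.trans_lt (hKs hr).2⟩
    rw [hz, neg_zero, hde] at this
    exact this
  refine ⟨∫ x, η₀ x • h x ∂(leb a b), ?_⟩
  set c := ∫ x, η₀ x • h x ∂(leb a b)
  have hint : ∀ ζ : ℝ → ℝ, Continuous ζ → HasCompactSupport ζ → Integrable ζ (leb a b) :=
    fun ζ hζ hc => by
      obtain ⟨C, hC⟩ := hc.exists_bound_of_continuous hζ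
      exact Integrable.of_bound hζ.aestronglyMeasurable C (Filter.Eventually.of_forall hC)
  have hloc : LocallyIntegrableOn (fun x => h x - c) (Ioo a b) (leb a b) :=
    (((l2_integrable h).sub (integrable_const c)).locallyIntegrable).locallyIntegrableOn _
  have := isOpen_Ioo.ae_eq_zero_of_integral_contDiff_smul_eq_zero hloc fun ζ hζ hc hs => by
    set m := ∫ x, ζ x ∂(leb a b)
    have h1 := key (fun x => ζ x - m * η₀ x) (hζ.sub (contDiff_const.mul hη₀))
      (hc.sub hc₀.mul_left)
      ((tsupport_sub _ _).trans (union_subset hs ((tsupport_mul_subset_right).trans hs₀))) (by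
        rw [integral_sub (hint ζ hζ.continuous hc) ((hint η₀ hη₀.continuous hc₀).const_mul m),
          integral_const_mul, hi₀, mul_one, sub_self])
    simp only [sub_smul, mul_smul] at h1
    have h2 : Integrable (fun x => m • η₀ x • h x) (leb a b) :=
      (integrable_smul hη₀.continuous hc₀ h).smul m
    rw [integral_sub (integrable_smul hζ.continuous hc h) h2, integral_smul, sub_eq_zero] at h1
    simp only [smul_sub]
    rw [integral_sub (integrable_smul hζ.continuous hc h)
      ((hint ζ hζ.continuous hc).smul_const c), integral_smul_const, h1, sub_self]
  have hne : ∀ᵐ x ∂(leb a b), x ∈ Ioo a b := by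
    rw [ae_restrict_iff' measurableSet_Icc]
    have h1 : ∀ᵐ x : ℝ, x ≠ a := by simp [ae_iff]
    have h2 : ∀ᵐ x : ℝ, x ≠ b := by simp [ae_iff]
    filter_upwards [h1, h2] with x hxa hxb hx
    exact ⟨lt_of_le_of_ne hx.1 (Ne.symm hxa), lt_of_le_of_ne hx.2 hxb⟩
  filter_upwards [this, hne] with x hx hxI
  exact sub_eq_zero.1 (hx hxI)

/-- The value at `x` of the continuous representative `x ↦ c + ∫_a^x g` of a function `f` with weak
derivative `g`: the constant `c` is the mean value of `f - ∫_a^· g` over `[a, b]`. -/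
def pointEval (a b : ℝ) (X : Type*) [NormedAddCommGroup X] [NormedSpace ℝ X] (x : ℝ) :
    L2 a b X × L2 a b X →L[ℝ] X :=
  (b - a)⁻¹ • (intTo a b X b).comp
      (ContinuousLinearMap.fst ℝ _ _ - (prim a b X).comp (ContinuousLinearMap.snd ℝ _ _))
    + (intTo a b X x).comp (ContinuousLinearMap.snd ℝ _ _)

theorem continuous_pointEval (f g : L2 a b X) : Continuous fun x => pointEval a b X x (f, g) := by
  simp only [pointEval, add_apply, ContinuousLinearMap.comp_apply,
    ContinuousLinearMap.coe_snd']
  exact continuous_const.add (continuous_intTo g)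

theorem IsWeakDeriv.ae_eq_pointEval [CompleteSpace X] (hab : a < b) {f g : L2 a b X}
    (H : IsWeakDeriv f g) : f =ᵐ[leb a b] fun x => pointEval a b X x (f, g) := by
  have h0 : IsWeakDeriv (f + (-1 : ℝ) • prim a b X g) (0 : L2 a b X) := by
    have := H.add ((isWeakDeriv_prim g).smul (-1))
    simpa using this
  obtain ⟨c, hc⟩ := h0.exists_const hab
  have hc' : f - prim a b X g =ᵐ[leb a b] fun _ => c := by
    simpa [sub_eq_add_neg] using hc
  have hmean : (b - a)⁻¹ • intTo a b X b (f - prim a b X g) = c := by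
    rw [intTo_apply, Measure.restrict_restrict measurableSet_Iic,
      show Iic b ∩ Icc a b = Icc a b from inter_eq_right.2 fun x hx => hx.2, integral_congr_ae hc']
    simp only [integral_const, MeasurableSet.univ, measureReal_restrict_apply, univ_inter,
      Real.volume_real_Icc_of_le hab.le]
    rw [smul_smul, inv_mul_cancel₀ (sub_ne_zero.2 hab.ne'), one_smul]
  filter_upwards [hc', Lp.coeFn_sub f (prim a b X g), coeFn_prim g] with x h1 h2 h3
  rw [h1, Pi.sub_apply, h3] at h2
  simp only [pointEval, add_apply, ContinuousLinearMap.comp_apply,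
    ContinuousLinearMap.coe_snd', smul_apply, sub_apply,
    ContinuousLinearMap.coe_fst']
  rw [hmean, h2]
  abel

end Calculus

section Closed

variable {a b : ℝ} {X : Type*} [NormedAddCommGroup X] [NormedSpace ℝ X]

theorem continuous_integral_smul {η : ℝ → ℝ} (hη : Continuous η) (hc : HasCompactSupport η) :
    Continuous fun f : L2 a b X => ∫ x, η x • f x ∂(leb a b) := by
  obtain ⟨C, hC⟩ := hc.exists_bound_of_continuous hη
  have hC0 : 0 ≤ C := (norm_nonneg _).trans (hC 0)
  refine AddMonoidHomClass.continuous_of_bound 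
    ({ toFun := fun f : L2 a b X => ∫ x, η x • f x ∂(leb a b)
       map_add' := fun f g => by
         rw [← integral_add (integrable_smul hη hc f) (integrable_smul hη hc g)]
         refine integral_congr_ae ?_
         filter_upwards [Lp.coeFn_add f g] with t ht
         rw [ht, Pi.add_apply, smul_add]
       map_smul' := fun c f => by
         rw [RingHom.id_apply, ← integral_smul]
         refine integral_congr_ae ?_
         filter_upwards [Lp.coeFn_smul c f] with t ht
         rw [ht, Pi.smul_apply, smul_comm] } : L2 a b X →ₗ[ℝ] X)
    (C * (leb a b).real univ ^ (1 / 2 : ℝ)) fun f => ?_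
  calc ‖∫ x, η x • f x ∂(leb a b)‖ ≤ ∫ x, C * ‖f x‖ ∂(leb a b) := by
        refine norm_integral_le_of_norm_le ((l2_integrable f).norm.const_mul C)
          (Filter.Eventually.of_forall fun x => ?_)
        rw [norm_smul]
        exact mul_le_mul_of_nonneg_right (hC x) (norm_nonneg _)
    _ ≤ C * (leb a b).real univ ^ (1 / 2 : ℝ) * ‖f‖ := by
        rw [integral_const_mul, mul_assoc]
        exact mul_le_mul_of_nonneg_left (l2_integral_norm_le f) hC0

end Closed

/-- The Sobolev space `H_k([a, b]; X)`: an element is a function `u 0 ∈ L₂` together with its weak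
derivatives `u 1, …, u k ∈ L₂`; the norm is the maximum of their `L₂` norms
(equivalent to the Hilbert norm). -/
def Sob (k : ℕ) (a b : ℝ) (X : Type*) [NormedAddCommGroup X] [NormedSpace ℝ X] :
    Submodule ℝ (Fin (k + 1) → L2 a b X) where
  carrier := {u | ∀ i : Fin k, IsWeakDeriv (u i.castSucc) (u i.succ)}
  add_mem' hu hv i := (hu i).add (hv i)
  zero_mem' _ := IsWeakDeriv.zero
  smul_mem' c _ hu i := (hu i).smul c

namespace Sob

variable {k : ℕ} {a b : ℝ} {X : Type*} [NormedAddCommGroup X] [NormedSpace ℝ X]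

/-- The `i`-th weak derivative `∂ⁱ : H_k → L₂`, for `i ≤ k`. -/
def der (i : Fin (k + 1)) : Sob k a b X →L[ℝ] L2 a b X :=
  (ContinuousLinearMap.proj i).comp (Sob k a b X).subtypeL

/-- The value `∂ⁱ u(x)` of the `i`-th derivative of `u ∈ H_k`, for `i < k` and `x ∈ [a, b]`. -/
def eval (i : Fin k) (x : ℝ) : Sob k a b X →L[ℝ] X :=
  (pointEval a b X x).comp ((der i.castSucc).prod (der i.succ))

theorem continuous_eval (i : Fin k) (u : Sob k a b X) : Continuous fun x => eval i x u :=
  continuous_pointEval _ _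

theorem ae_eq_eval [CompleteSpace X] (hab : a < b) (i : Fin k) (u : Sob k a b X) :
    der i.castSucc u =ᵐ[leb a b] fun x => eval i x u :=
  (u.2 i).ae_eq_pointEval hab

theorem der_eq_constL_add_prim [CompleteSpace X] (hab : a < b) (i : Fin k) (u : Sob k a b X) :
    der i.castSucc u = constL a b X (eval i a u) + prim a b X (der i.succ u) := by
  refine Lp.ext ?_
  filter_upwards [ae_eq_eval hab i u, Lp.coeFn_add (constL a b X (eval i a u))
    (prim a b X (der i.succ u)), coeFn_constL (a := a) (b := b) (eval i a u),
    coeFn_prim (der i.succ u)] with x h1 h2 h3 h4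
  have h5 : intTo a b X a (der i.succ u) = 0 := by
    rw [intTo_eq_intervalIntegral (left_mem_Icc.2 hab.le), intervalIntegral.integral_same]
  rw [h1, h2, Pi.add_apply, h3, h4]
  simp only [eval, pointEval, ContinuousLinearMap.comp_apply, add_apply,
    ContinuousLinearMap.prod_apply, ContinuousLinearMap.coe_snd', h5, add_zero]

theorem isClosed : IsClosed (Sob k a b X : Set (Fin (k + 1) → L2 a b X)) := by
  have h : (Sob k a b X : Set (Fin (k + 1) → L2 a b X)) = ⋂ (i : Fin k) (η : ℝ → ℝ)
      (_ : ContDiff ℝ ∞ η) (_ : HasCompactSupport η) (_ : tsupport η ⊆ Ioo a b),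
      {u | ∫ x, _root_.deriv η x • u i.castSucc x ∂(leb a b)
        = -∫ x, η x • u i.succ x ∂(leb a b)} := by
    ext u
    simp only [mem_iInter]
    rfl
  rw [h]
  refine isClosed_iInter fun i => isClosed_iInter fun η => isClosed_iInter fun hη =>
    isClosed_iInter fun hc => isClosed_iInter fun _ => isClosed_eq ?_ ?_
  · exact (continuous_integral_smul (hη.continuous_deriv (by simp)) hc.deriv).comp
      (continuous_apply _)
  · exact ((continuous_integral_smul hη.continuous hc).comp (continuous_apply _)).neg

instance [CompleteSpace X] : CompleteSpace (Sob k a b X) := isClosed.completeSpace_coe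

end Sob

/-- The function in `H₁` with value `c` at `a` and weak derivative `g`, for given `(c, g)`. -/
def cauchy1 (a b : ℝ) : ℝ × L2 a b ℝ →L[ℝ] Sob 1 a b ℝ :=
  ContinuousLinearMap.codRestrict
    (ContinuousLinearMap.pi
      ![(constL a b ℝ).coprod (prim a b ℝ), ContinuousLinearMap.snd ℝ ℝ (L2 a b ℝ)])
    (Sob 1 a b ℝ) fun p i => by
      have := (isWeakDeriv_constL (a := a) (b := b) p.1).add (isWeakDeriv_prim p.2)
      rw [zero_add] at this
      fin_cases i
      exact this

/-- The function in `H₂` with value `c` and derivative `d` at `a` and second weak derivative `g`,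
for given `(c, d, g)`. -/
def cauchy2 (a b : ℝ) : ℝ × ℝ × L2 a b ℝ →L[ℝ] Sob 2 a b ℝ :=
  ContinuousLinearMap.codRestrict
    (ContinuousLinearMap.pi
      ![(constL a b ℝ).coprod ((prim a b ℝ).comp ((constL a b ℝ).coprod (prim a b ℝ))),
        ((constL a b ℝ).coprod (prim a b ℝ)).comp (ContinuousLinearMap.snd ℝ ℝ (ℝ × L2 a b ℝ)),
        (ContinuousLinearMap.snd ℝ ℝ (L2 a b ℝ)).comp
          (ContinuousLinearMap.snd ℝ ℝ (ℝ × L2 a b ℝ))])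
    (Sob 2 a b ℝ) fun p i => by
      have h1 := (isWeakDeriv_constL (a := a) (b := b) p.2.1).add (isWeakDeriv_prim p.2.2)
      have h0 := (isWeakDeriv_constL (a := a) (b := b) p.1).add
        (isWeakDeriv_prim (constL a b ℝ p.2.1 + prim a b ℝ p.2.2))
      rw [zero_add] at h0 h1
      fin_cases i
      · exact h0
      · exact h1

/-! ### The state spaces -/

/-- `L₂^{n₁+n₂+n₃}([a, b])`, in three blocks. -/
def Fund (a b : ℝ) (n₁ n₂ n₃ : ℕ) : Type :=
  (Fin n₁ → L2 a b ℝ) × (Fin n₂ → L2 a b ℝ) × (Fin n₃ → L2 a b ℝ)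

instance (a b : ℝ) (n₁ n₂ n₃ : ℕ) : NormedAddCommGroup (Fund a b n₁ n₂ n₃) :=
  inferInstanceAs (NormedAddCommGroup ((Fin n₁ → L2 a b ℝ) × (Fin n₂ → L2 a b ℝ) × (Fin n₃ → L2 a b ℝ)))

instance (a b : ℝ) (n₁ n₂ n₃ : ℕ) : NormedSpace ℝ (Fund a b n₁ n₂ n₃) :=
  inferInstanceAs (NormedSpace ℝ ((Fin n₁ → L2 a b ℝ) × (Fin n₂ → L2 a b ℝ) × (Fin n₃ → L2 a b ℝ)))

instance (a b : ℝ) (n₁ n₂ n₃ : ℕ) : CompleteSpace (Fund a b n₁ n₂ n₃) :=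
  inferInstanceAs (CompleteSpace ((Fin n₁ → L2 a b ℝ) × (Fin n₂ → L2 a b ℝ) × (Fin n₃ → L2 a b ℝ)))

/-- `U = L₂^{n₁} × H₁^{n₂} × H₂^{n₃}` on `[a, b]`. -/
def State (a b : ℝ) (n₁ n₂ n₃ : ℕ) : Type :=
  (Fin n₁ → L2 a b ℝ) × (Fin n₂ → Sob 1 a b ℝ) × (Fin n₃ → Sob 2 a b ℝ)

instance (a b : ℝ) (n₁ n₂ n₃ : ℕ) : NormedAddCommGroup (State a b n₁ n₂ n₃) :=
  inferInstanceAs (NormedAddCommGroup ((Fin n₁ → L2 a b ℝ) × (Fin n₂ → Sob 1 a b ℝ) × (Fin n₃ → Sob 2 a b ℝ)))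

instance (a b : ℝ) (n₁ n₂ n₃ : ℕ) : NormedSpace ℝ (State a b n₁ n₂ n₃) :=
  inferInstanceAs (NormedSpace ℝ ((Fin n₁ → L2 a b ℝ) × (Fin n₂ → Sob 1 a b ℝ) × (Fin n₃ → Sob 2 a b ℝ)))

instance (a b : ℝ) (n₁ n₂ n₃ : ℕ) : CompleteSpace (State a b n₁ n₂ n₃) :=
  inferInstanceAs (CompleteSpace ((Fin n₁ → L2 a b ℝ) × (Fin n₂ → Sob 1 a b ℝ) × (Fin n₃ → Sob 2 a b ℝ)))

/-- Index set of the components of `(u₁, u₂, u₃, ∂ₓu₂, ∂ₓu₃, ∂ₓ²u₃)`. -/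
abbrev IntIdx (n₁ n₂ n₃ : ℕ) :=
  Fin n₁ ⊕ Fin n₂ ⊕ Fin n₃ ⊕ Fin n₂ ⊕ Fin n₃ ⊕ Fin n₃

/-- Index set of the components of `(u₂, u₃, ∂ₓu₃)` at an endpoint. -/
abbrev EndIdx (n₂ n₃ : ℕ) := Fin n₂ ⊕ Fin n₃ ⊕ Fin n₃

/-- Index set of the components of the boundary data at `a` and at `b`. -/
abbrev BfIdx (n₂ n₃ : ℕ) := EndIdx n₂ n₃ ⊕ EndIdx n₂ n₃

/-- The space of the data `(𝒟_int u, Λ_bf u, z)`. -/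
abbrev Signal (a b : ℝ) (n₁ n₂ n₃ nz : ℕ) :=
  (IntIdx n₁ n₂ n₃ → L2 a b ℝ) × (BfIdx n₂ n₃ → ℝ) × (Fin nz → ℝ)

section Operators

variable {a b : ℝ} {n₁ n₂ n₃ nz : ℕ}

/-- The first block of an element of `L₂^{n₁+n₂+n₃}`. -/
def Fund.c₁ : Fund a b n₁ n₂ n₃ →L[ℝ] (Fin n₁ → L2 a b ℝ) :=
  ContinuousLinearMap.fst ℝ (Fin n₁ → L2 a b ℝ) ((Fin n₂ → L2 a b ℝ) × (Fin n₃ → L2 a b ℝ))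

/-- The second block of an element of `L₂^{n₁+n₂+n₃}`. -/
def Fund.c₂ : Fund a b n₁ n₂ n₃ →L[ℝ] (Fin n₂ → L2 a b ℝ) :=
  (ContinuousLinearMap.fst ℝ (Fin n₂ → L2 a b ℝ) (Fin n₃ → L2 a b ℝ)).comp
    (.snd ℝ (Fin n₁ → L2 a b ℝ) ((Fin n₂ → L2 a b ℝ) × (Fin n₃ → L2 a b ℝ)))

/-- The third block of an element of `L₂^{n₁+n₂+n₃}`. -/
def Fund.c₃ : Fund a b n₁ n₂ n₃ →L[ℝ] (Fin n₃ → L2 a b ℝ) :=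
  (ContinuousLinearMap.snd ℝ (Fin n₂ → L2 a b ℝ) (Fin n₃ → L2 a b ℝ)).comp
    (.snd ℝ (Fin n₁ → L2 a b ℝ) ((Fin n₂ → L2 a b ℝ) × (Fin n₃ → L2 a b ℝ)))

/-- The map into `L₂^{n₁+n₂+n₃}` with given blocks. -/
def Fund.mk {E : Type*} [NormedAddCommGroup E] [NormedSpace ℝ E]
    (f₁ : E →L[ℝ] (Fin n₁ → L2 a b ℝ)) (f₂ : E →L[ℝ] (Fin n₂ → L2 a b ℝ))
    (f₃ : E →L[ℝ] (Fin n₃ → L2 a b ℝ)) : E →L[ℝ] Fund a b n₁ n₂ n₃ :=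
  f₁.prod (f₂.prod f₃)

/-- The first block of `u ∈ U`. -/
def State.c₁ : State a b n₁ n₂ n₃ →L[ℝ] (Fin n₁ → L2 a b ℝ) :=
  ContinuousLinearMap.fst ℝ (Fin n₁ → L2 a b ℝ) ((Fin n₂ → Sob 1 a b ℝ) × (Fin n₃ → Sob 2 a b ℝ))

/-- The second block of `u ∈ U`. -/
def State.c₂ : State a b n₁ n₂ n₃ →L[ℝ] (Fin n₂ → Sob 1 a b ℝ) :=
  (ContinuousLinearMap.fst ℝ (Fin n₂ → Sob 1 a b ℝ) (Fin n₃ → Sob 2 a b ℝ)).comp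
    (.snd ℝ (Fin n₁ → L2 a b ℝ) ((Fin n₂ → Sob 1 a b ℝ) × (Fin n₃ → Sob 2 a b ℝ)))

/-- The third block of `u ∈ U`. -/
def State.c₃ : State a b n₁ n₂ n₃ →L[ℝ] (Fin n₃ → Sob 2 a b ℝ) :=
  (ContinuousLinearMap.snd ℝ (Fin n₂ → Sob 1 a b ℝ) (Fin n₃ → Sob 2 a b ℝ)).comp
    (.snd ℝ (Fin n₁ → L2 a b ℝ) ((Fin n₂ → Sob 1 a b ℝ) × (Fin n₃ → Sob 2 a b ℝ)))

/-- The map into `U` with given blocks. -/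
def State.mk {E : Type*} [NormedAddCommGroup E] [NormedSpace ℝ E]
    (f₁ : E →L[ℝ] (Fin n₁ → L2 a b ℝ)) (f₂ : E →L[ℝ] (Fin n₂ → Sob 1 a b ℝ))
    (f₃ : E →L[ℝ] (Fin n₃ → Sob 2 a b ℝ)) : E →L[ℝ] State a b n₁ n₂ n₃ :=
  f₁.prod (f₂.prod f₃)

/-- The inclusion `U ⊆ L₂^{n₁+n₂+n₃}`. -/
def incl : State a b n₁ n₂ n₃ →L[ℝ] Fund a b n₁ n₂ n₃ :=
  Fund.mk State.c₁
    (ContinuousLinearMap.pi fun i => (Sob.der 0).comp ((ContinuousLinearMap.proj i).comp State.c₂))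
    (ContinuousLinearMap.pi fun i => (Sob.der 0).comp ((ContinuousLinearMap.proj i).comp State.c₃))

/-- `𝒟u = (u₁, ∂ₓu₂, ∂ₓ²u₃)`. -/
def fund : State a b n₁ n₂ n₃ →L[ℝ] Fund a b n₁ n₂ n₃ :=
  Fund.mk State.c₁
    (ContinuousLinearMap.pi fun i => (Sob.der 1).comp ((ContinuousLinearMap.proj i).comp State.c₂))
    (ContinuousLinearMap.pi fun i => (Sob.der 2).comp ((ContinuousLinearMap.proj i).comp State.c₃))

/-- `𝒟_int u = (u₁, u₂, u₃, ∂ₓu₂, ∂ₓu₃, ∂ₓ²u₃)`. -/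
def Dint : State a b n₁ n₂ n₃ →L[ℝ] (IntIdx n₁ n₂ n₃ → L2 a b ℝ) :=
  ContinuousLinearMap.pi fun
    | .inl i => (ContinuousLinearMap.proj i).comp State.c₁
    | .inr (.inl i) => (Sob.der 0).comp ((ContinuousLinearMap.proj i).comp State.c₂)
    | .inr (.inr (.inl i)) => (Sob.der 0).comp ((ContinuousLinearMap.proj i).comp State.c₃)
    | .inr (.inr (.inr (.inl i))) =>
      (Sob.der 1).comp ((ContinuousLinearMap.proj i).comp State.c₂)
    | .inr (.inr (.inr (.inr (.inl i)))) =>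
      (Sob.der 1).comp ((ContinuousLinearMap.proj i).comp State.c₃)
    | .inr (.inr (.inr (.inr (.inr i)))) =>
      (Sob.der 2).comp ((ContinuousLinearMap.proj i).comp State.c₃)

/-- `(u₂(x), u₃(x), ∂ₓu₃(x))`. -/
def endData (x : ℝ) : State a b n₁ n₂ n₃ →L[ℝ] (EndIdx n₂ n₃ → ℝ) :=
  ContinuousLinearMap.pi fun
    | .inl i => (Sob.eval 0 x).comp ((ContinuousLinearMap.proj i).comp State.c₂)
    | .inr (.inl i) => (Sob.eval 0 x).comp ((ContinuousLinearMap.proj i).comp State.c₃)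
    | .inr (.inr i) => (Sob.eval 1 x).comp ((ContinuousLinearMap.proj i).comp State.c₃)

/-- `Λ_bf u`: the values of `(u₂, u₃, ∂ₓu₃)` at `a` and at `b`. -/
def Lbf : State a b n₁ n₂ n₃ →L[ℝ] (BfIdx n₂ n₃ → ℝ) :=
  ContinuousLinearMap.pi fun
    | .inl i => (ContinuousLinearMap.proj i).comp (endData a)
    | .inr i => (ContinuousLinearMap.proj i).comp (endData b)

/-- The data `(𝒟_int u, Λ_bf u, z)` of a pair `(u, z)`. -/
def signal : State a b n₁ n₂ n₃ × (Fin nz → ℝ) →L[ℝ] Signal a b n₁ n₂ n₃ nz :=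
  (Dint.comp (ContinuousLinearMap.fst ℝ _ _)).prod ((Lbf.comp (ContinuousLinearMap.fst ℝ _ _)).prod (ContinuousLinearMap.snd ℝ _ _))

/-- The function `u ∈ U` with `(u₂(a), u₃(a), ∂ₓu₃(a)) = c` and
`𝒟u = (u₁, ∂ₓu₂, ∂ₓ²u₃) = v`, for given `(c, v)`:
`u₁ = v₁`, `u₂(x) = c₂ + ∫_a^x v₂`, `u₃(x) = c₃ + ∫_a^x (d₃ + ∫_a^θ v₃)dθ`. -/
def cauchy : (EndIdx n₂ n₃ → ℝ) × Fund a b n₁ n₂ n₃ →L[ℝ] State a b n₁ n₂ n₃ :=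
  State.mk (Fund.c₁.comp (ContinuousLinearMap.snd ℝ _ _))
    (ContinuousLinearMap.pi fun i => (cauchy1 a b).comp <|
      ((ContinuousLinearMap.proj (.inl i)).comp (ContinuousLinearMap.fst ℝ _ _)).prod
        ((ContinuousLinearMap.proj i).comp (Fund.c₂.comp (ContinuousLinearMap.snd ℝ _ _))))
    (ContinuousLinearMap.pi fun i => (cauchy2 a b).comp <|
      ((ContinuousLinearMap.proj (.inr (.inl i))).comp (ContinuousLinearMap.fst ℝ _ _)).prod <|
        ((ContinuousLinearMap.proj (.inr (.inr i))).comp (ContinuousLinearMap.fst ℝ _ _)).prod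
          ((ContinuousLinearMap.proj i).comp (Fund.c₃.comp (ContinuousLinearMap.snd ℝ _ _))))

theorem cauchy_endData_fund (hab : a < b) (u : State a b n₁ n₂ n₃) :
    cauchy (endData a u, fund u) = u := by
  refine Prod.ext rfl (Prod.ext (funext fun i => Subtype.ext ?_) (funext fun i => Subtype.ext ?_))
  · refine funext fun j => ?_
    fin_cases j
    · exact (Sob.der_eq_constL_add_prim hab 0 (u.2.1 i)).symm
    · rfl
  · have e1 := Sob.der_eq_constL_add_prim hab 1 (u.2.2 i)
    have e0 := Sob.der_eq_constL_add_prim hab 0 (u.2.2 i)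
    refine funext fun j => ?_
    fin_cases j
    · refine Eq.trans ?_ e0.symm
      exact congrArg (fun f => constL a b ℝ _ + prim a b ℝ f) e1.symm
    · exact e1.symm
    · rfl

end Operators

/-! ### Boundary conditions and the operators `𝒯`, `𝒯_z` -/

/-- Parameters `{E_p, E_b, E_z}` of the boundary conditions
`∫_a^b E_p(x) (𝒟_int u)(x) dx + E_b Λ_bf u + E_z z = 0`; the entries of `E_p` are in `L₂`. -/
structure BCParams (a b : ℝ) (n₁ n₂ n₃ nz nbc : ℕ) where
  Ep : Matrix (Fin nbc) (IntIdx n₁ n₂ n₃) (L2 a b ℝ)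
  Eb : Matrix (Fin nbc) (BfIdx n₂ n₃) ℝ
  Ez : Matrix (Fin nbc) (Fin nz) ℝ

namespace BCParams

variable {a b : ℝ} {n₁ n₂ n₃ nz nbc : ℕ} (G : BCParams a b n₁ n₂ n₃ nz nbc)

/-- The boundary functional `(w, β, z) ↦ ∫_a^b E_p(x) w(x) dx + E_b β + E_z z`. -/
def bc : Signal a b n₁ n₂ n₃ nz →L[ℝ] (Fin nbc → ℝ) :=
  .coprod
    (ContinuousLinearMap.pi fun i => ∑ j, (innerSL ℝ (G.Ep i j)).comp (.proj j))
    (.coprod (Matrix.toLin' G.Eb).toContinuousLinearMap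
      (Matrix.toLin' G.Ez).toContinuousLinearMap)

theorem bc_apply (w : IntIdx n₁ n₂ n₃ → L2 a b ℝ) (β : BfIdx n₂ n₃ → ℝ) (z : Fin nz → ℝ)
    (i : Fin nbc) :
    G.bc (w, β, z) i = (∑ j, ∫ x in Icc a b, G.Ep i j x * w j x)
      + (G.Eb.mulVec β i + G.Ez.mulVec z i) := by
  have h : ∀ j, inner ℝ (G.Ep i j) (w j) = ∫ x in Icc a b, G.Ep i j x * w j x := fun j => by
    rw [MeasureTheory.L2.inner_def]
    exact integral_congr_ae (Filter.Eventually.of_forall fun x => by simp [mul_comm])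
  simp [bc, h, -Fintype.sum_sum_type]

/-- The map `c ↦ BC(u_c)`, where `u_c ∈ ker 𝒟` has boundary data `c` at `a`. -/
def ET : (EndIdx n₂ n₃ → ℝ) →L[ℝ] (Fin nbc → ℝ) :=
  G.bc.comp (signal.comp (.prod (cauchy.comp (.prod (.id ℝ _) 0)) 0))

theorem ET_apply (c : EndIdx n₂ n₃ → ℝ) : G.ET c = G.bc (signal (cauchy (c, 0), 0)) := rfl

/-- The boundary conditions are well-posed: there are as many of them as there are free constants
in `ker 𝒟`, namely `n₂ + 2n₃`, and the matrix of `E_T` is invertible. -/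
def WellPosed : Prop := Function.Bijective G.ET

variable {G}

/-- The inverse matrix `E_T⁻¹`, as a linear map. -/
def WellPosed.inv (h : G.WellPosed) : (Fin nbc → ℝ) →L[ℝ] (EndIdx n₂ n₃ → ℝ) :=
  (LinearEquiv.ofBijective G.ET.toLinearMap h).symm.toLinearMap.toContinuousLinearMap

/-- The operator `𝒯` from the fundamental state `v = 𝒟u` to the state `u`:
`𝒯v = u_v - K E_T⁻¹ BC(u_v)`, where `u_v` is the solution of `𝒟u = v` with zero boundary data at `a`
and `K c = u_c`. In kernel form it is the 3-PI operator
`(𝒯v)(x) = G₀ v(x) + ∫_a^x G₁(x, θ) v(θ) dθ + ∫_x^b G₂(x, θ) v(θ) dθ` with `G₀ = diag(I, 0, 0)`,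
`G₁(x, θ) = diag(0, I, (x - θ)I) + G₂(x, θ)` and `G₂(x, θ) = -K(x) E_T⁻¹ E_Q(θ)`, where
`BC(u_v) = ∫_a^b E_Q(θ) v(θ) dθ`. -/
def WellPosed.T (h : G.WellPosed) : Fund a b n₁ n₂ n₃ →L[ℝ] State a b n₁ n₂ n₃ :=
  cauchy.comp (.prod
    (-(h.inv.comp (G.bc.comp (signal.comp (.prod (cauchy.comp (.prod 0 (.id ℝ _))) 0)))))
    (.id ℝ _))

/-- The operator `𝒯_z z = -K E_T⁻¹ E_z z`. -/
def WellPosed.Tz (h : G.WellPosed) : (Fin nz → ℝ) →L[ℝ] State a b n₁ n₂ n₃ :=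
  cauchy.comp (.prod
    (-(h.inv.comp (G.bc.comp (signal.comp (.prod 0 (.id ℝ _))))))
    0)

/-- `𝒟(𝒯v + 𝒯_z z) = v`. -/
theorem WellPosed.fund_T_add_Tz (h : G.WellPosed) (v : Fund a b n₁ n₂ n₃) (z : Fin nz → ℝ) :
    fund (h.T v + h.Tz z) = v := by
  have e : ∀ (c : EndIdx n₂ n₃ → ℝ) (v : Fund a b n₁ n₂ n₃), fund (cauchy (c, v)) = v :=
    fun c v => rfl
  rw [map_add]
  simp only [T, Tz, ContinuousLinearMap.comp_apply, ContinuousLinearMap.prod_apply]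
  rw [e, e]
  simp

/-- `𝒯v + 𝒯_z z` satisfies the boundary conditions. -/
theorem WellPosed.bc_T_add_Tz (h : G.WellPosed) (v : Fund a b n₁ n₂ n₃) (z : Fin nz → ℝ) :
    G.bc (signal (h.T v + h.Tz z, z)) = 0 := by
  have hinv : ∀ y, G.bc (signal (cauchy (h.inv y, (0 : Fund a b n₁ n₂ n₃)), (0 : Fin nz → ℝ))) = y :=
    fun y => (G.ET_apply _).symm.trans
      ((LinearEquiv.ofBijective G.ET.toLinearMap h).apply_symm_apply y)
  have e : ((h.T v + h.Tz z, z) : State a b n₁ n₂ n₃ × (Fin nz → ℝ))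
      = (cauchy ((0 : EndIdx n₂ n₃ → ℝ), v), 0) + (0, z)
        - (cauchy (h.inv (G.bc (signal (cauchy ((0 : EndIdx n₂ n₃ → ℝ), v), (0 : Fin nz → ℝ)))),
            (0 : Fund a b n₁ n₂ n₃)), 0)
        - (cauchy (h.inv (G.bc (signal ((0 : State a b n₁ n₂ n₃), z))),
            (0 : Fund a b n₁ n₂ n₃)), 0) := by
    refine Prod.ext ?_ (by simp)
    simp only [T, Tz, ContinuousLinearMap.comp_apply, ContinuousLinearMap.prod_apply]
    simp only [Prod.fst_sub, Prod.fst_add, ← map_add]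
    rw [add_zero, ← map_sub, ← map_sub]
    congr 1
    refine Prod.ext ?_ ?_ <;> simp
    abel
  rw [e]
  simp only [map_sub, map_add]
  rw [hinv, hinv]
  abel

/-- Every `(u, z)` satisfying the boundary conditions has `u = 𝒯𝒟u + 𝒯_z z`. -/
theorem WellPosed.T_fund_add_Tz (hab : a < b) (h : G.WellPosed) (u : State a b n₁ n₂ n₃)
    (z : Fin nz → ℝ) (hu : G.bc (signal (u, z)) = 0) : h.T (fund u) + h.Tz z = u := by
  set w := u - (h.T (fund u) + h.Tz z) with hw
  have h1 : G.bc (signal (w, (0 : Fin nz → ℝ))) = 0 := by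
    have e : ((w, 0) : State a b n₁ n₂ n₃ × (Fin nz → ℝ))
        = (u, z) - (h.T (fund u) + h.Tz z, z) := by simp [hw]
    rw [e, map_sub, map_sub, hu, h.bc_T_add_Tz, sub_zero]
  have h2 : fund w = 0 := by rw [hw, map_sub, h.fund_T_add_Tz, sub_self]
  have h3 := cauchy_endData_fund hab w
  rw [h2] at h3
  have h4 : G.ET (endData a w) = G.ET 0 := by
    rw [map_zero, ET_apply, h3, h1]
  rw [h.1 h4, ← Prod.zero_eq_mk, map_zero] at h3
  exact (sub_eq_zero.1 h3.symm).symm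

end BCParams

/-! ### Partial integral equations -/

/-- Operators `{T, T_w, A, B_w, C, D}` of a PIE `T_w wₜ + T vₜ = A v + B_w w`, `y = C v + D w`
with state `v`, input `w`, output `y`. -/
structure PIE (S W Y : Type*) [NormedAddCommGroup S] [NormedSpace ℝ S] [NormedAddCommGroup W]
    [NormedSpace ℝ W] [NormedAddCommGroup Y] [NormedSpace ℝ Y] where
  T : S →L[ℝ] S
  Tw : W →L[ℝ] S
  A : S →L[ℝ] S
  Bw : W →L[ℝ] S
  C : S →L[ℝ] Y
  D : W →L[ℝ] Y

/-- `(v, y)` is a solution to the PIE with input `w` and initial condition `v₀`: `v` and `w` are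
differentiable on `[0, ∞)`, `v(0) = v₀` and the equations hold for all `t ≥ 0`. -/
def PIE.IsSolution {S W Y : Type*} [NormedAddCommGroup S] [NormedSpace ℝ S] [NormedAddCommGroup W]
    [NormedSpace ℝ W] [NormedAddCommGroup Y] [NormedSpace ℝ Y] (P : PIE S W Y)
    (w : ℝ → W) (v₀ : S) (v : ℝ → S) (y : ℝ → Y) : Prop :=
  v 0 = v₀ ∧ ∃ (v' : ℝ → S) (w' : ℝ → W), ∀ t, 0 ≤ t →
    HasDerivWithinAt v (v' t) (Ici 0) t ∧ HasDerivWithinAt w (w' t) (Ici 0) t ∧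
    P.Tw (w' t) + P.T (v' t) = P.A (v t) + P.Bw (w t) ∧
    y t = P.C (v t) + P.D (w t)

/-! ### The transport equation -/

/-- `L₂` functions of `s ∈ [0, 1]` with values in `L₂^{n₁+n₂+n₃}([a, b]) × ℝ^{nz}`, that is
`L₂^{n₁+n₂+n₃}([0, 1] × [a, b]) × L₂^{nz}([0, 1])`. -/
abbrev DelayL2 (a b : ℝ) (n₁ n₂ n₃ nz : ℕ) :=
  L2 0 1 (Fund a b n₁ n₂ n₃) × L2 0 1 (Fin nz → ℝ)

/-- `H₁([0, 1]; U) × H₁^{nz}([0, 1])`; the first factor consists of the functions of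
`(s, x) ∈ [0, 1] × [a, b]` whose three blocks have orders of differentiability
`(0, 1)`, `(1, 1)`, `(2, 1)` in `(x, s)`. -/
abbrev DelaySob (a b : ℝ) (n₁ n₂ n₃ nz : ℕ) :=
  Sob 1 0 1 (State a b n₁ n₂ n₃) × Sob 1 0 1 (Fin nz → ℝ)

section Transport

variable {a b : ℝ} {n₁ n₂ n₃ nz nbc : ℕ}

/-- The inclusion of the Sobolev space in the `L₂` space. -/
def DelaySob.toL2 : DelaySob a b n₁ n₂ n₃ nz →L[ℝ] DelayL2 a b n₁ n₂ n₃ nz :=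
  ((incl.compLpL 2 (leb 0 1)).comp (Sob.der 0)).prodMap (Sob.der 0)

/-- The value `φ(s) ∈ U × ℝ^{nz}` of `φ` at `s ∈ [0, 1]`. -/
def DelaySob.at (s : ℝ) : DelaySob a b n₁ n₂ n₃ nz →L[ℝ] State a b n₁ n₂ n₃ × (Fin nz → ℝ) :=
  (Sob.eval 0 s).prodMap (Sob.eval 0 s)

/-- `T_q (𝒟_int u, Λ_bf u, z) = (u, z)`. -/
def Tq₀ : Signal a b n₁ n₂ n₃ nz →L[ℝ] Fund a b n₁ n₂ n₃ × (Fin nz → ℝ) :=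
  ((Fund.mk (ContinuousLinearMap.pi fun i => .proj (.inl i)) (ContinuousLinearMap.pi fun i => .proj (.inr (.inl i)))
      (ContinuousLinearMap.pi fun i => .proj (.inr (.inr (.inl i))))).comp
        (.fst ℝ (IntIdx n₁ n₂ n₃ → L2 a b ℝ) _)).prod
    ((ContinuousLinearMap.snd ℝ _ _).comp (ContinuousLinearMap.snd ℝ _ _))

/-- `T_q q` as a function on `[0, 1]` that does not depend on `s`. -/
def Tq : Signal a b n₁ n₂ n₃ nz →L[ℝ] DelayL2 a b n₁ n₂ n₃ nz :=
  ((constL 0 1 _).prodMap (constL 0 1 _)).comp Tq₀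

/-- `s ↦ R ψ_u(s) + S ψ_z(s)`. -/
def multiplier {Y : Type*} [NormedAddCommGroup Y] [NormedSpace ℝ Y]
    (R : Fund a b n₁ n₂ n₃ →L[ℝ] Y) (S : (Fin nz → ℝ) →L[ℝ] Y) :
    DelayL2 a b n₁ n₂ n₃ nz →L[ℝ] L2 0 1 Y :=
  (R.compLpL 2 (leb 0 1)).coprod (S.compLpL 2 (leb 0 1))

namespace BCParams

/-- The domain `Y_q`: `φ(0) = T_q q`, and `φ(s)` satisfies the boundary conditions for all
`s ∈ [0, 1]`. -/
def Y (G : BCParams a b n₁ n₂ n₃ nz nbc) (q : Signal a b n₁ n₂ n₃ nz) :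
    Set (DelaySob a b n₁ n₂ n₃ nz) :=
  {φ | (incl (φ.at 0).1, (φ.at 0).2) = Tq₀ q ∧ ∀ s ∈ Icc (0 : ℝ) 1, G.bc (signal (φ.at s)) = 0}

/-- `(φ, r)` is a solution to the transport equation `φₜ = -(1/τ) φ_s`, `φ(t) ∈ Y_{q(t)}`, with
output `r(t) = (𝒟_int φ_u(t, 1), Λ_bf φ_u(t, 1), φ_z(t, 1))`, input `q` and initial condition `φ₀`.
Here `φ` is differentiable on `[0, ∞)` with respect to the Sobolev norm, and `Φ t` is `φ t`
regarded as an element of the Sobolev space. -/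
def IsTransportSolution (G : BCParams a b n₁ n₂ n₃ nz nbc) (τ : ℝ)
    (q : ℝ → Signal a b n₁ n₂ n₃ nz) (φ₀ : DelayL2 a b n₁ n₂ n₃ nz)
    (φ : ℝ → DelayL2 a b n₁ n₂ n₃ nz) (r : ℝ → Signal a b n₁ n₂ n₃ nz) : Prop :=
  φ 0 = φ₀ ∧ ∃ Φ Φ' : ℝ → DelaySob a b n₁ n₂ n₃ nz, ∀ t, 0 ≤ t →
    (Φ t).toL2 = φ t ∧ HasDerivWithinAt Φ (Φ' t) (Ici 0) t ∧ Φ t ∈ G.Y (q t) ∧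
    Sob.der 0 (Φ' t).1 = -(1 / τ) • Sob.der 1 (Φ t).1 ∧
    Sob.der 0 (Φ' t).2 = -(1 / τ) • Sob.der 1 (Φ t).2 ∧
    r t = signal ((Φ t).at 1)

variable {G : BCParams a b n₁ n₂ n₃ nz nbc}

/-- `(𝒯̄ψ)(s) = ∫_0^s (𝒯ψ_u(θ) + 𝒯_z ψ_z(θ), ψ_z(θ)) dθ`. -/
def WellPosed.Tbar (h : G.WellPosed) : DelayL2 a b n₁ n₂ n₃ nz →L[ℝ] DelayL2 a b n₁ n₂ n₃ nz :=
  .prod ((prim 0 1 _).comp (multiplier (incl.comp h.T) (incl.comp h.Tz)))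
    ((prim 0 1 _).comp (ContinuousLinearMap.snd ℝ _ _))

/-- `(𝒜̄ψ)(s) = -(1/τ) (𝒯ψ_u(s) + 𝒯_z ψ_z(s), ψ_z(s))`. -/
def WellPosed.Abar (h : G.WellPosed) (τ : ℝ) :
    DelayL2 a b n₁ n₂ n₃ nz →L[ℝ] DelayL2 a b n₁ n₂ n₃ nz :=
  -(1 / τ) • .prod (multiplier (incl.comp h.T) (incl.comp h.Tz)) (ContinuousLinearMap.snd ℝ _ _)

/-- `𝒞̄ψ = ∫_0^1 (𝒯_int ψ_u + 𝒯_{int,z} ψ_z, 𝒯_bf ψ_u + 𝒯_{bf,z} ψ_z, ψ_z) ds`, where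
`𝒯_int = 𝒟_int ∘ 𝒯`, `𝒯_{int,z} = 𝒟_int ∘ 𝒯_z`, `𝒯_bf = Λ_bf ∘ 𝒯`, `𝒯_{bf,z} = Λ_bf ∘ 𝒯_z`. -/
def WellPosed.Cbar (h : G.WellPosed) : DelayL2 a b n₁ n₂ n₃ nz →L[ℝ] Signal a b n₁ n₂ n₃ nz :=
  .prod ((intTo 0 1 _ 1).comp (multiplier (Dint.comp h.T) (Dint.comp h.Tz))) <|
    .prod ((intTo 0 1 _ 1).comp (multiplier (Lbf.comp h.T) (Lbf.comp h.Tz)))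
      ((intTo 0 1 _ 1).comp (ContinuousLinearMap.snd ℝ _ _))

/-- The PIE `{𝒯̄, T_q, 𝒜̄, 0, 𝒞̄, I}`. -/
def WellPosed.transportPIE (h : G.WellPosed) (τ : ℝ) :
    PIE (DelayL2 a b n₁ n₂ n₃ nz) (Signal a b n₁ n₂ n₃ nz) (Signal a b n₁ n₂ n₃ nz) where
  T := h.Tbar
  Tw := Tq
  A := h.Abar τ
  Bw := 0
  C := h.Cbar
  D := .id ℝ _

end BCParams

end Transport

end DelayPIE

end

open DelayPIE

noncomputable section

namespace DelayPIE

open MeasureTheory Set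
open scoped ContDiff

/-! ### Bounded operators, primitives and weak derivatives for vector-valued `L2` functions -/

section Calculus

variable {a b : ℝ} {X Y : Type*} [NormedAddCommGroup X] [NormedSpace ℝ X]
  [NormedAddCommGroup Y] [NormedSpace ℝ Y]

/-! The substitution `φ = 𝒯̄ψ + T_q q` is an integral from `0` to `s`. Write `p = (u, z)` for the
pair with data `q`, and let `lift (p, ψ)` be the `U × ℝ^{nz}`-valued function `s ↦ p + ∫_0^s (𝒯ψ_u +
𝒯_z ψ_z, ψ_z)`. It lies in the Sobolev space, depends linearly and continuously on `(p, ψ)`, and its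
image in `L₂` is `φ` (`WellPosed.toL2_lift`). The inclusion of the Sobolev space in `L₂` is
injective, so the lift is the only Sobolev representative of `φ`.

The lift can be undone by bounded operators: its value at `s = 0` is `p`, its `s`-derivative has
second component `ψ_z`, and `𝒟` applied to the first component gives `ψ_u`, because `𝒟(𝒯v + 𝒯_z z) =
v`. In addition `p` and `q` determine each other linearly and continuously (`recover`, `signal`).
Hence `(q, ψ)` is differentiable in `t` exactly when the lift is, in the Sobolev norm.

The equations then correspond term by term. The left side of the PIE is the lift of `(p', ψ')` seen
in `L₂`, where `p'` is the derivative of `p`, and `𝒜̄ψ` is `-(1/τ) ∂_s` of the lift of `(p, ψ)` seen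
in `L₂`; injectivity of `U → L₂` turns this into the transport equation with values in `U`
(`WellPosed.toL2_eq_Abar_iff`). The outputs agree because `𝒟_int` and `Λ_bf` commute with the
integral over `[0, 1]`.

What remains is the boundary condition. The integrand satisfies it pointwise, so `BC(φ(t, s)) =
BC(q(t))` for every `s`, and it must be shown that `BC(q(t)) = 0`. Only `BC(q(0)) = 0` is assumed,
but applying `BC` to the PIE annihilates both the integral term and the right side. This leaves
`BC(q'(t)) = 0`, so `BC(q(t))` is constant in time. -/

theorem intTo_compLpL [CompleteSpace X] [CompleteSpace Y] (L : X →L[ℝ] Y) (x : ℝ) (f : L2 a b X) :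
    intTo a b Y x (L.compLpL 2 (leb a b) f) = L (intTo a b X x f) := by
  rw [intTo_apply, intTo_apply, ← L.integral_comp_comm (l2_integrable f).integrableOn]
  exact integral_congr_ae (ae_restrict_of_ae (L.coeFn_compLpL f))

theorem prim_compLpL [CompleteSpace X] [CompleteSpace Y] (L : X →L[ℝ] Y) (f : L2 a b X) :
    prim a b Y (L.compLpL 2 (leb a b) f) = L.compLpL 2 (leb a b) (prim a b X f) := by
  refine Lp.ext ?_
  filter_upwards [coeFn_prim (L.compLpL 2 (leb a b) f), L.coeFn_compLpL (prim a b X f),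
    coeFn_prim f] with x h1 h2 h3
  rw [h1, h2, h3, intTo_compLpL]

theorem constL_compLpL (L : X →L[ℝ] Y) (c : X) :
    L.compLpL 2 (leb a b) (constL a b X c) = constL a b Y (L c) := by
  refine Lp.ext ?_
  filter_upwards [coeFn_constL (a := a) (b := b) (L c), L.coeFn_compLpL (constL a b X c),
    coeFn_constL (a := a) (b := b) c] with x h1 h2 h3
  rw [h1, h2, h3]

theorem compLpL_injective {L : X →L[ℝ] Y} (hL : Function.Injective L) :
    Function.Injective (L.compLpL 2 (leb a b)) := by
  intro f g h
  refine Lp.ext ?_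
  filter_upwards [L.coeFn_compLpL f, L.coeFn_compLpL g] with x h1 h2
  apply hL
  rw [← h1, ← h2, h]

theorem constL_injective (hab : a < b) : Function.Injective (constL a b X) := by
  -- The measure is nonzero because `a < b`; an almost-everywhere statement therefore holds at some
  -- point.
  have : NeZero (leb a b) := ⟨by simp [leb, Measure.restrict_eq_zero, hab]⟩
  intro c d h
  have h1 : ∀ᵐ _ ∂(leb a b), c = d := by
    filter_upwards [coeFn_constL (a := a) (b := b) c, coeFn_constL (a := a) (b := b) d] with x h1 h2
    rw [← h1, ← h2, h]
  exact h1.exists.choose_spec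

theorem ae_mem_Ioo : ∀ᵐ x ∂(leb a b), x ∈ Ioo a b := by
  rw [leb, Measure.restrict_congr_set Ioo_ae_eq_Icc.symm]
  exact ae_restrict_mem measurableSet_Ioo

/-- The only weak derivative of the zero function is zero. -/
theorem IsWeakDeriv.eq_zero [CompleteSpace X] {g : L2 a b X} (H : IsWeakDeriv (0 : L2 a b X) g) : g = 0 := by
  have hz : ∀ ζ : ℝ → ℝ, ∫ x, ζ x • (0 : L2 a b X) x ∂(leb a b) = 0 := fun ζ => by
    refine integral_eq_zero_of_ae ?_
    filter_upwards [Lp.coeFn_zero X 2 (leb a b)] with x hx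
    rw [hx]
    simp
  -- Fundamental lemma of the calculus of variations. It gives vanishing on the open interval only;
  -- the endpoints are a null set.
  have := isOpen_Ioo.ae_eq_zero_of_integral_contDiff_smul_eq_zero (μ := leb a b) (U := Ioo a b)
    ((l2_integrable g).locallyIntegrable.locallyIntegrableOn _) fun ζ hζ hc hs => by
      have := H ζ hζ hc hs
      rw [hz] at this
      exact neg_eq_zero.1 this.symm
  refine Lp.ext ?_
  filter_upwards [this, ae_mem_Ioo (a := a) (b := b), Lp.coeFn_zero X 2 (leb a b)] with x h1 h2 h3
  rw [h1 h2, h3]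
  rfl

/-- An element of `Sob` is a tuple of a function and its weak derivatives; uniqueness of weak
derivatives makes the tuple redundant, so the Sobolev space really is a space of functions. -/
theorem Sob.der_zero_injective [CompleteSpace X] :
    Function.Injective (Sob.der 0 : Sob 1 a b X →L[ℝ] L2 a b X) := by
  rw [injective_iff_map_eq_zero]
  intro u hu
  have h1 : IsWeakDeriv (u.1 0) (u.1 1) := u.2 0
  have h0 : u.1 0 = 0 := hu
  rw [h0] at h1
  refine Subtype.ext (funext fun i => ?_)
  fin_cases i
  · exact h0
  · exact h1.eq_zero

/-- The function in `H₁([a, b]; X)` with value `c` at `a` and weak derivative `g`. -/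
def Sob.ofInit (a b : ℝ) (X : Type*) [NormedAddCommGroup X] [NormedSpace ℝ X] [CompleteSpace X] :
    X × L2 a b X →L[ℝ] Sob 1 a b X :=
  ContinuousLinearMap.codRestrict
    (ContinuousLinearMap.pi
      ![(constL a b X).coprod (prim a b X), ContinuousLinearMap.snd ℝ X (L2 a b X)])
    (Sob 1 a b X) fun p i => by
      have := (isWeakDeriv_constL (a := a) (b := b) p.1).add (isWeakDeriv_prim p.2)
      rw [zero_add] at this
      fin_cases i
      exact this

theorem Sob.der_one_ofInit [CompleteSpace X] (c : X) (g : L2 a b X) :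
    Sob.der 1 (Sob.ofInit a b X (c, g)) = g := rfl

theorem intTo_left (hab : a < b) (f : L2 a b X) : intTo a b X a f = 0 := by
  rw [intTo_eq_intervalIntegral (left_mem_Icc.2 hab.le), intervalIntegral.integral_same]

/-- This is the fundamental theorem of calculus for the representative picked by `pointEval`, which
is normalised by a mean value and not by its value at `a`. -/
theorem Sob.eval_ofInit [CompleteSpace X] (hab : a < b) (x : ℝ) (c : X) (g : L2 a b X) :
    Sob.eval 0 x (Sob.ofInit a b X (c, g)) = c + intTo a b X x g := by
  set u := Sob.ofInit a b X (c, g)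
  -- Two decompositions of the same function as constant plus primitive of `g`: the constants must
  -- agree.
  have h1 : Sob.eval 0 a u = c := by
    have h := Sob.der_eq_constL_add_prim hab 0 u
    have h' : constL a b X c + prim a b X g = constL a b X (Sob.eval 0 a u) + prim a b X g := h
    exact (constL_injective hab (add_right_cancel h')).symm
  -- The mean-value term in `pointEval` does not depend on the point, so it cancels in the
  -- difference of two values.
  have h2 : Sob.eval 0 x u = Sob.eval 0 a u - intTo a b X a g + intTo a b X x g := by
    have hd : Sob.der (Fin.succ 0) u = g := rfl
    simp only [Sob.eval, pointEval, ContinuousLinearMap.comp_apply, add_apply,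
      ContinuousLinearMap.prod_apply, ContinuousLinearMap.coe_snd', hd]
    abel
  rw [h2, h1, intTo_left hab, sub_zero]

end Calculus

/-! ### Injectivity of the inclusions, and recovering `(u, z)` from its data -/

section Transport

variable {a b : ℝ} {n₁ n₂ n₃ nz nbc : ℕ}

/-- Uniqueness of weak derivatives, used once for the `H₁` components and twice in succession for
the `H₂` components. It allows identities in `L₂` to be read as identities in `U`. -/
theorem incl_injective :
    Function.Injective (incl : State a b n₁ n₂ n₃ →L[ℝ] Fund a b n₁ n₂ n₃) := by
  have h2 : Function.Injective (Sob.der 0 : Sob 2 a b ℝ →L[ℝ] L2 a b ℝ) := by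
    rw [injective_iff_map_eq_zero]
    intro u hu
    have h0 : u.1 0 = 0 := hu
    have h1 : IsWeakDeriv (u.1 0) (u.1 1) := u.2 0
    have h2 : IsWeakDeriv (u.1 1) (u.1 2) := u.2 1
    rw [h0] at h1
    have e1 := h1.eq_zero
    rw [e1] at h2
    refine Subtype.ext (funext fun i => ?_)
    fin_cases i
    · exact h0
    · exact e1
    · exact h2.eq_zero
  intro u v h
  refine Prod.ext (congrArg (fun w => w.1) h :) (Prod.ext (funext fun i => ?_) (funext fun i => ?_))
  · exact Sob.der_zero_injective (congrFun (congrArg (fun w => w.2.1) h) i)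
  · exact h2 (congrFun (congrArg (fun w => w.2.2) h) i)

theorem DelaySob.toL2_injective :
    Function.Injective (DelaySob.toL2 : DelaySob a b n₁ n₂ n₃ nz →L[ℝ] _) := by
  intro φ χ h
  exact Prod.ext (Sob.der_zero_injective (compLpL_injective incl_injective (congrArg Prod.fst h)))
    (Sob.der_zero_injective (congrArg Prod.snd h))

/-- The pair `(u, z)` with data `(𝒟_int u, Λ_bf u, z)`. -/
def recover : Signal a b n₁ n₂ n₃ nz →L[ℝ] State a b n₁ n₂ n₃ × (Fin nz → ℝ) :=
  (cauchy.comp (.prod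
    ((ContinuousLinearMap.pi fun i => .proj (.inl i)).comp
      ((ContinuousLinearMap.fst ℝ (BfIdx n₂ n₃ → ℝ) (Fin nz → ℝ)).comp (.snd ℝ _ _)))
    ((Fund.mk (ContinuousLinearMap.pi fun i => .proj (.inl i))
      (ContinuousLinearMap.pi fun i => .proj (.inr (.inr (.inr (.inl i)))))
      (ContinuousLinearMap.pi fun i => .proj (.inr (.inr (.inr (.inr (.inr i))))))).comp
        (.fst ℝ (IntIdx n₁ n₂ n₃ → L2 a b ℝ) _)))).prod
    ((ContinuousLinearMap.snd ℝ _ _).comp (ContinuousLinearMap.snd ℝ _ _))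

/-- The data contain the values at `a` and all of `𝒟u`, and these determine `u`. Consequently
differentiability of the input `q` in its `L₂` and Euclidean norms already controls `q_u` in the
norm of `U`. -/
theorem recover_signal (hab : a < b) (p : State a b n₁ n₂ n₃ × (Fin nz → ℝ)) :
    recover (signal p) = p :=
  Prod.ext (cauchy_endData_fund hab p.1) rfl

theorem Tq₀_signal (p : State a b n₁ n₂ n₃ × (Fin nz → ℝ)) :
    Tq₀ (signal p) = (incl p.1, p.2) := rfl

theorem multiplier_comp {Y Z : Type*} [NormedAddCommGroup Y] [NormedSpace ℝ Y]
    [NormedAddCommGroup Z] [NormedSpace ℝ Z] (L : Y →L[ℝ] Z)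
    (R : Fund a b n₁ n₂ n₃ →L[ℝ] Y) (S : (Fin nz → ℝ) →L[ℝ] Y) (ψ : DelayL2 a b n₁ n₂ n₃ nz) :
    multiplier (L.comp R) (L.comp S) ψ = L.compLpL 2 (leb 0 1) (multiplier R S ψ) := by
  simp only [multiplier, ContinuousLinearMap.coprod_apply]
  refine Lp.ext ?_
  filter_upwards [Lp.coeFn_add ((L.comp R).compLpL 2 (leb 0 1) ψ.1)
      ((L.comp S).compLpL 2 (leb 0 1) ψ.2),
    L.coeFn_compLpL (R.compLpL 2 (leb 0 1) ψ.1 + S.compLpL 2 (leb 0 1) ψ.2),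
    Lp.coeFn_add (R.compLpL 2 (leb 0 1) ψ.1) (S.compLpL 2 (leb 0 1) ψ.2),
    (L.comp R).coeFn_compLpL ψ.1, (L.comp S).coeFn_compLpL ψ.2,
    R.coeFn_compLpL ψ.1, S.coeFn_compLpL ψ.2] with s h1 h2 h3 h4 h5 h6 h7
  rw [h1, h2, h3, Pi.add_apply, Pi.add_apply, h4, h5, h6, h7, map_add]
  rfl

/-! ### The lift of `(p, ψ)` to the Sobolev space -/

namespace BCParams

variable {G : BCParams a b n₁ n₂ n₃ nz nbc}

/-- The function `s ↦ p + ∫_0^s (𝒯ψ_u(θ) + 𝒯_z ψ_z(θ), ψ_z(θ)) dθ` in the Sobolev space, for given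
`(p, ψ)`. -/
def WellPosed.lift (h : G.WellPosed) :
    (State a b n₁ n₂ n₃ × (Fin nz → ℝ)) × DelayL2 a b n₁ n₂ n₃ nz →L[ℝ]
      DelaySob a b n₁ n₂ n₃ nz :=
  .prod
    ((Sob.ofInit 0 1 _).comp (.prod ((ContinuousLinearMap.fst ℝ _ _).comp (.fst ℝ _ _))
      ((multiplier h.T h.Tz).comp (.snd ℝ _ _))))
    ((Sob.ofInit 0 1 _).comp (.prod ((ContinuousLinearMap.snd ℝ _ _).comp (.fst ℝ _ _))
      ((ContinuousLinearMap.snd ℝ _ _).comp (.snd ℝ _ _))))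

theorem WellPosed.lift_apply (h : G.WellPosed) (p : State a b n₁ n₂ n₃ × (Fin nz → ℝ))
    (ψ : DelayL2 a b n₁ n₂ n₃ nz) : h.lift (p, ψ)
      = (Sob.ofInit 0 1 _ (p.1, multiplier h.T h.Tz ψ), Sob.ofInit 0 1 _ (p.2, ψ.2)) := rfl

/-- The inclusion `U → L₂` commutes with constants, with primitives in `s` and with the pointwise
operators `𝒯`, `𝒯_z`. Thus the regularity hidden in `𝒯̄ψ + T_q q` is exhibited by the lift. -/
theorem WellPosed.toL2_lift (h : G.WellPosed) (p : State a b n₁ n₂ n₃ × (Fin nz → ℝ))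
    (ψ : DelayL2 a b n₁ n₂ n₃ nz) :
    (h.lift (p, ψ)).toL2 = h.Tbar ψ + Tq (signal p) := by
  refine Prod.ext ?_ ?_
  · change incl.compLpL 2 (leb 0 1) (constL 0 1 _ p.1 + prim 0 1 _ (multiplier h.T h.Tz ψ))
      = prim 0 1 _ (multiplier (incl.comp h.T) (incl.comp h.Tz) ψ) + constL 0 1 _ (incl p.1)
    rw [map_add, constL_compLpL, multiplier_comp, prim_compLpL, add_comm]
  · change constL 0 1 _ p.2 + prim 0 1 _ ψ.2 = prim 0 1 _ ψ.2 + constL 0 1 _ p.2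
    exact add_comm _ _

theorem WellPosed.lift_at (h : G.WellPosed) (p : State a b n₁ n₂ n₃ × (Fin nz → ℝ))
    (ψ : DelayL2 a b n₁ n₂ n₃ nz) (s : ℝ) :
    (h.lift (p, ψ)).at s
      = p + (intTo 0 1 _ s (multiplier h.T h.Tz ψ), intTo 0 1 _ s ψ.2) :=
  Prod.ext (Sob.eval_ofInit one_pos s _ _) (Sob.eval_ofInit one_pos s _ _)

theorem WellPosed.lift_at_zero (h : G.WellPosed) (p : State a b n₁ n₂ n₃ × (Fin nz → ℝ))
    (ψ : DelayL2 a b n₁ n₂ n₃ nz) : (h.lift (p, ψ)).at 0 = p := by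
  rw [h.lift_at, intTo_left one_pos, intTo_left one_pos]
  exact add_zero p

/-- `𝒟(𝒯ψ_u + 𝒯_z ψ_z) = ψ_u`, pointwise in `s`. -/
theorem WellPosed.fund_multiplier (h : G.WellPosed) (ψ : DelayL2 a b n₁ n₂ n₃ nz) :
    fund.compLpL 2 (leb 0 1) (multiplier h.T h.Tz ψ) = ψ.1 := by
  refine Lp.ext ?_
  simp only [multiplier, ContinuousLinearMap.coprod_apply]
  filter_upwards [fund.coeFn_compLpL (h.T.compLpL 2 (leb 0 1) ψ.1 + h.Tz.compLpL 2 (leb 0 1) ψ.2),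
    Lp.coeFn_add (h.T.compLpL 2 (leb 0 1) ψ.1) (h.Tz.compLpL 2 (leb 0 1) ψ.2),
    h.T.coeFn_compLpL ψ.1, h.Tz.coeFn_compLpL ψ.2] with s h1 h2 h3 h4
  rw [h1, h2, Pi.add_apply, h3, h4, h.fund_T_add_Tz]

/-- The boundary functional as a function of `u` (for `z = 0`). -/
def bcU (G : BCParams a b n₁ n₂ n₃ nz nbc) : State a b n₁ n₂ n₃ →L[ℝ] (Fin nbc → ℝ) :=
  (G.bc.comp signal).comp (.inl ℝ _ _)

/-- The boundary functional as a function of `z` (for `u = 0`). -/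
def bcZ (G : BCParams a b n₁ n₂ n₃ nz nbc) : (Fin nz → ℝ) →L[ℝ] (Fin nbc → ℝ) :=
  (G.bc.comp signal).comp (.inr ℝ _ _)

theorem bcU_add_bcZ (p : State a b n₁ n₂ n₃ × (Fin nz → ℝ)) :
    G.bcU p.1 + G.bcZ p.2 = G.bc (signal p) := by
  simp only [bcU, bcZ, ContinuousLinearMap.comp_apply, ← map_add]
  simp

/-- `(𝒯ψ_u + 𝒯_z ψ_z, ψ_z)` satisfies the boundary conditions, pointwise in `s`. -/
theorem WellPosed.bc_multiplier (h : G.WellPosed) (ψ : DelayL2 a b n₁ n₂ n₃ nz) :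
    G.bcU.compLpL 2 (leb 0 1) (multiplier h.T h.Tz ψ) + G.bcZ.compLpL 2 (leb 0 1) ψ.2 = 0 := by
  refine Lp.ext ?_
  simp only [multiplier, ContinuousLinearMap.coprod_apply]
  set w := h.T.compLpL 2 (leb 0 1) ψ.1 + h.Tz.compLpL 2 (leb 0 1) ψ.2 with hw
  filter_upwards [Lp.coeFn_add (G.bcU.compLpL 2 (leb 0 1) w) (G.bcZ.compLpL 2 (leb 0 1) ψ.2),
    G.bcU.coeFn_compLpL w, G.bcZ.coeFn_compLpL ψ.2,
    Lp.coeFn_add (h.T.compLpL 2 (leb 0 1) ψ.1) (h.Tz.compLpL 2 (leb 0 1) ψ.2),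
    h.T.coeFn_compLpL ψ.1, h.Tz.coeFn_compLpL ψ.2,
    Lp.coeFn_zero (Fin nbc → ℝ) 2 (leb 0 1)] with s h1 h2 h3 h4 h5 h6 h7
  rw [h1, h7, Pi.add_apply, h2, h3, hw, h4, Pi.add_apply, h5, h6]
  exact (bcU_add_bcZ (h.T (ψ.1 s) + h.Tz (ψ.2 s), ψ.2 s)).trans (h.bc_T_add_Tz _ _)

/-- `BC` is bounded and linear, so it passes under the integral in `s`, where the integrand
satisfies the homogeneous condition. Only the contribution of the initial value `p` survives. -/
theorem WellPosed.bc_lift_at (h : G.WellPosed) (p : State a b n₁ n₂ n₃ × (Fin nz → ℝ))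
    (ψ : DelayL2 a b n₁ n₂ n₃ nz) (s : ℝ) :
    G.bc (signal ((h.lift (p, ψ)).at s)) = G.bc (signal p) := by
  rw [h.lift_at, map_add, map_add, ← bcU_add_bcZ (intTo 0 1 _ s _, intTo 0 1 _ s ψ.2)]
  dsimp only
  rw [← intTo_compLpL, ← intTo_compLpL, ← map_add, h.bc_multiplier, map_zero, add_zero]

theorem WellPosed.lift_mem_Y (h : G.WellPosed) {p : State a b n₁ n₂ n₃ × (Fin nz → ℝ)}
    (hp : G.bc (signal p) = 0) (ψ : DelayL2 a b n₁ n₂ n₃ nz) :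
    h.lift (p, ψ) ∈ G.Y (signal p) := by
  refine ⟨?_, fun s _ => by rw [h.bc_lift_at, hp]⟩
  rw [h.lift_at_zero, Tq₀_signal]

/-- At `s = 1` the integral runs over the whole interval, and `𝒟_int`, `Λ_bf` can be moved inside
it. -/
theorem WellPosed.signal_lift_at_one (h : G.WellPosed) (p : State a b n₁ n₂ n₃ × (Fin nz → ℝ))
    (ψ : DelayL2 a b n₁ n₂ n₃ nz) :
    signal ((h.lift (p, ψ)).at 1) = h.Cbar ψ + signal p := by
  rw [h.lift_at, map_add, add_comm]
  congr 1
  refine Prod.ext ?_ (Prod.ext ?_ rfl)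
  · change Dint (intTo 0 1 _ 1 (multiplier h.T h.Tz ψ))
      = intTo 0 1 _ 1 (multiplier (Dint.comp h.T) (Dint.comp h.Tz) ψ)
    rw [multiplier_comp, intTo_compLpL]
  · change Lbf (intTo 0 1 _ 1 (multiplier h.T h.Tz ψ))
      = intTo 0 1 _ 1 (multiplier (Lbf.comp h.T) (Lbf.comp h.Tz) ψ)
    rw [multiplier_comp, intTo_compLpL]

/-- `𝒜̄ψ` is `-(1/τ) ∂_s` of the lift of `ψ`, in the `L₂` space. -/
theorem WellPosed.toL2_eq_Abar_iff (h : G.WellPosed) (τ : ℝ)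
    (p : State a b n₁ n₂ n₃ × (Fin nz → ℝ)) (ψ : DelayL2 a b n₁ n₂ n₃ nz)
    (χ : DelaySob a b n₁ n₂ n₃ nz) :
    χ.toL2 = h.Abar τ ψ ↔
      Sob.der 0 χ.1 = -(1 / τ) • Sob.der 1 (h.lift (p, ψ)).1 ∧
      Sob.der 0 χ.2 = -(1 / τ) • Sob.der 1 (h.lift (p, ψ)).2 := by
  rw [Prod.ext_iff]
  refine and_congr ?_ Iff.rfl
  -- The `s`-derivative of the lift is the integrand, whatever `p` is; the two sides then differ
  -- only by the injective map `incl`.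
  change incl.compLpL 2 (leb 0 1) (Sob.der 0 χ.1)
      = -(1 / τ) • multiplier (incl.comp h.T) (incl.comp h.Tz) ψ ↔
    Sob.der 0 χ.1 = -(1 / τ) • multiplier h.T h.Tz ψ
  rw [multiplier_comp, ← map_smul, (compLpL_injective incl_injective).eq_iff]

/-- The velocity of the input satisfies the boundary conditions. -/
theorem WellPosed.bc_eq_zero_of_toL2_lift_eq_Abar (h : G.WellPosed) (τ : ℝ)
    {p : State a b n₁ n₂ n₃ × (Fin nz → ℝ)} {ψ ψ' : DelayL2 a b n₁ n₂ n₃ nz}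
    (e : (h.lift (p, ψ')).toL2 = h.Abar τ ψ) : G.bc (signal p) = 0 := by
  -- The hypothesis holds in `L₂`, where boundary values make no sense; it is first upgraded to an
  -- identity of `U`-valued functions.
  obtain ⟨e1, e2⟩ := (h.toL2_eq_Abar_iff τ p ψ _).1 e
  replace e1 : constL 0 1 _ p.1 + prim 0 1 _ (multiplier h.T h.Tz ψ')
    = -(1 / τ) • multiplier h.T h.Tz ψ := e1
  replace e2 : constL 0 1 _ p.2 + prim 0 1 _ ψ'.2 = -(1 / τ) • ψ.2 := e2
  -- `BC` is applied at almost every `s`. The terms in `ψ'` and `ψ` vanish by `bc_multiplier`, and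
  -- the constant `BC(p)` is left.
  have e3 := congrArg₂ (fun f g => G.bcU.compLpL 2 (leb 0 1) f + G.bcZ.compLpL 2 (leb 0 1) g) e1 e2
  simp only [map_add, map_smul, constL_compLpL, ← prim_compLpL] at e3
  rw [add_add_add_comm, ← smul_add, ← map_add, ← map_add, h.bc_multiplier, h.bc_multiplier,
    map_zero, smul_zero, add_zero, bcU_add_bcZ, ← map_zero (constL 0 1 (Fin nbc → ℝ))] at e3
  exact constL_injective one_pos e3

end BCParams

/-- If the values of `q` are data of pairs `(u, z)`, then so is its derivative. -/
theorem signal_recover_of_hasDerivWithinAt {q : ℝ → Signal a b n₁ n₂ n₃ nz}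
    (hq : ∀ t, 0 ≤ t → signal (recover (q t)) = q t) {q' : Signal a b n₁ n₂ n₃ nz} {t : ℝ}
    (ht : 0 ≤ t) (h : HasDerivWithinAt q q' (Ici 0) t) : signal (recover q') = q' := by
  -- `q` is fixed by the bounded operator `signal ∘ recover` on `[0, ∞)`; differentiating this and
  -- using uniqueness of the one-sided derivative gives the same for `q'`.
  have h1 := ((signal.comp recover).hasFDerivAt.comp_hasDerivWithinAt t h).congr
    (f₁ := q) (fun s hs => (hq s hs).symm) (hq t ht).symm
  exact (uniqueDiffOn_Ici (0 : ℝ) t ht).eq_deriv _ h1 h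

/-! ### The two implications between PIE and transport equation -/

namespace BCParams

variable {G : BCParams a b n₁ n₂ n₃ nz nbc}

theorem WellPosed.isTransportSolution_of_isSolution
    (h : G.WellPosed) (τ : ℝ)
    {q : ℝ → Signal a b n₁ n₂ n₃ nz} (hrec : ∀ t, 0 ≤ t → signal (recover (q t)) = q t)
    (hq₀ : G.bc (q 0) = 0)
    {ψ₀ : DelayL2 a b n₁ n₂ n₃ nz} {ψ : ℝ → DelayL2 a b n₁ n₂ n₃ nz}
    {r : ℝ → Signal a b n₁ n₂ n₃ nz}
    (H : (h.transportPIE τ).IsSolution q ψ₀ ψ r) :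
    G.IsTransportSolution τ q (h.Tbar ψ₀ + Tq (q 0))
      (fun t => h.Tbar (ψ t) + Tq (q t)) r := by
  obtain ⟨hψ0, ψ', q', H⟩ := H
  -- The PIE equation, with its left side recognised as the lift of the velocities.
  have hvel : ∀ t, 0 ≤ t →
      (h.lift (recover (q' t), ψ' t)).toL2 = h.Abar τ (ψ t) := fun t ht => by
    obtain ⟨-, h2, h3, -⟩ := H t ht
    have h3' : Tq (q' t) + h.Tbar (ψ' t) = h.Abar τ (ψ t) + 0 := h3
    rw [h.toL2_lift, signal_recover_of_hasDerivWithinAt hrec ht h2, add_comm, h3', add_zero]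
  -- The boundary condition propagates from `t = 0`, since `BC(q(t))` has zero derivative.
  have hbc : ∀ t, 0 ≤ t → G.bc (q t) = 0 := fun t ht => by
    have hd : ∀ x, 0 ≤ x → HasDerivWithinAt (fun s => G.bc (q s)) 0 (Ici 0) x := by
      intro x hx
      obtain ⟨-, h2, -, -⟩ := H x hx
      have h4 := G.bc.hasFDerivAt.comp_hasDerivWithinAt x h2
      rw [← signal_recover_of_hasDerivWithinAt hrec hx h2,
        h.bc_eq_zero_of_toL2_lift_eq_Abar τ (hvel x hx)] at h4
      exact h4
    rw [← hq₀]
    exact constant_of_has_deriv_right_zero (a := 0) (b := t)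
      (fun x hx => ((hd x hx.1).continuousWithinAt).mono Icc_subset_Ici_self)
      (fun x hx => (hd x hx.1).mono (Ici_subset_Ici.2 hx.1)) t ⟨ht, le_rfl⟩
  refine ⟨by simp only [hψ0], fun t => h.lift (recover (q t), ψ t),
    fun t => h.lift (recover (q' t), ψ' t), fun t ht => ?_⟩
  obtain ⟨h1, h2, -, h4⟩ := H t ht
  have hY := h.lift_mem_Y (p := recover (q t)) (by rw [hrec t ht, hbc t ht]) (ψ t)
  rw [hrec t ht] at hY
  refine ⟨by rw [h.toL2_lift, hrec t ht], ?_, hY, ?_⟩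
  · exact h.lift.hasFDerivAt.comp_hasDerivWithinAt t
      ((recover.hasFDerivAt.comp_hasDerivWithinAt t h2).prodMk h1)
  · obtain ⟨e1, e2⟩ := (h.toL2_eq_Abar_iff τ (recover (q t)) (ψ t) _).1 (hvel t ht)
    refine ⟨e1, e2, ?_⟩
    rw [h.signal_lift_at_one, hrec t ht, h4]
    rfl

theorem WellPosed.isSolution_of_isTransportSolution
    (h : G.WellPosed) (τ : ℝ)
    {q : ℝ → Signal a b n₁ n₂ n₃ nz} (hrec : ∀ t, 0 ≤ t → signal (recover (q t)) = q t)
    {ψ₀ : DelayL2 a b n₁ n₂ n₃ nz} {ψ : ℝ → DelayL2 a b n₁ n₂ n₃ nz}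
    {r : ℝ → Signal a b n₁ n₂ n₃ nz}
    (H : G.IsTransportSolution τ q (h.Tbar ψ₀ + Tq (q 0))
      (fun t => h.Tbar (ψ t) + Tq (q t)) r) :
    (h.transportPIE τ).IsSolution q ψ₀ ψ r := by
  obtain ⟨h0, Φ, Φ', H⟩ := H
  -- The representative `Φ` is only known to exist; injectivity into `L₂` forces it to be the lift.
  have hΦ : ∀ t, 0 ≤ t → Φ t = h.lift (recover (q t), ψ t) := fun t ht =>
    DelaySob.toL2_injective (by rw [(H t ht).1, h.toL2_lift, hrec t ht])
  have hψ : ∀ t, 0 ≤ t → ψ t = (fund.compLpL 2 (leb 0 1) (Sob.der 1 (Φ t).1),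
      Sob.der 1 (Φ t).2) := fun t ht => by
    rw [hΦ t ht, h.lift_apply, Sob.der_one_ofInit, Sob.der_one_ofInit, h.fund_multiplier]
  have hqΦ : ∀ t, 0 ≤ t → q t = signal ((Φ t).at 0) := fun t ht => by
    rw [hΦ t ht, h.lift_at_zero, hrec t ht]
  -- The operator `(𝒟∂_s, ∂_s)`, which takes the lift of `(p, ψ)` back to `ψ`. It transfers
  -- differentiability from `Φ` to `ψ`, as evaluation at `s = 0` does for `q`.
  let D : DelaySob a b n₁ n₂ n₃ nz →L[ℝ] DelayL2 a b n₁ n₂ n₃ nz :=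
    ((fund.compLpL 2 (leb 0 1)).comp (Sob.der 1)).prodMap (Sob.der 1)
  have dψ : ∀ t, 0 ≤ t → HasDerivWithinAt ψ (D (Φ' t)) (Ici 0) t := fun t ht =>
    (D.hasFDerivAt.comp_hasDerivWithinAt t (H t ht).2.1).congr (fun s hs => hψ s hs) (hψ t ht)
  have dq : ∀ t, 0 ≤ t →
      HasDerivWithinAt q ((signal.comp (DelaySob.at 0)) (Φ' t)) (Ici 0) t := fun t ht =>
    ((signal.comp (DelaySob.at 0)).hasFDerivAt.comp_hasDerivWithinAt t (H t ht).2.1).congr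
      (fun s hs => hqΦ s hs) (hqΦ t ht)
  refine ⟨?_, fun t => D (Φ' t), fun t => (signal.comp (DelaySob.at 0)) (Φ' t),
    fun t ht => ⟨dψ t ht, dq t ht, ?_, ?_⟩⟩
  · have e : h.lift (recover (q 0), ψ 0) = h.lift (recover (q 0), ψ₀) :=
      DelaySob.toL2_injective (by
        rw [h.toL2_lift, h.toL2_lift, hrec 0 le_rfl]
        exact h0)
    rw [hψ 0 le_rfl, hΦ 0 le_rfl, e, h.lift_apply, Sob.der_one_ofInit, Sob.der_one_ofInit,
      h.fund_multiplier]
  · obtain ⟨h1, h2, -, h4, h5, -⟩ := H t ht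
    rw [hΦ t ht] at h4 h5
    have e1 := (h.toL2_eq_Abar_iff τ (recover (q t)) (ψ t) (Φ' t)).2 ⟨h4, h5⟩
    -- The time derivative of `φ` in `L₂` is computed twice, from `Φ` and from `𝒯̄ψ + T_q q`.
    -- Equating the results gives the PIE.
    have e2 := (DelaySob.toL2.hasFDerivAt.comp_hasDerivWithinAt t h2).congr
      (f₁ := fun s => h.Tbar (ψ s) + Tq (q s)) (fun s hs => ((H s hs).1).symm) h1.symm
    have e3 := (h.Tbar.hasFDerivAt.comp_hasDerivWithinAt t (dψ t ht)).add
      (Tq.hasFDerivAt.comp_hasDerivWithinAt t (dq t ht))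
    have e4 := (uniqueDiffOn_Ici (0 : ℝ) t ht).eq_deriv _ e2 e3
    rw [e1] at e4
    exact (add_comm _ _).trans (e4.symm.trans (add_zero _).symm)
  · rw [(H t ht).2.2.2.2.2, hΦ t ht, h.signal_lift_at_one, hrec t ht]
    rfl

end BCParams

end Transport

end DelayPIE

end

theorem mainTheorem10 {a b : ℝ} (hab : a < b) {n₁ n₂ n₃ nz nbc K : ℕ}
    (G : BCParams a b n₁ n₂ n₃ nz nbc) (hG : G.WellPosed)
    (τ : Fin K → ℝ) (hτ : ∀ j, 0 < τ j)
    (q : ℝ → Signal a b n₁ n₂ n₃ nz) (qu : ℝ → State a b n₁ n₂ n₃) (qz : ℝ → Fin nz → ℝ)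
    (hq : ∀ t, 0 ≤ t → q t = (Dint (qu t), Lbf (qu t), qz t)) (hq₀ : G.bc (q 0) = 0)
    (j : Fin K) (ψ₀ : DelayL2 a b n₁ n₂ n₃ nz) :
    hG.Tbar ψ₀ + Tq (q 0) ∈ DelaySob.toL2 '' G.Y (q 0) ∧
    ∀ (ψ : ℝ → DelayL2 a b n₁ n₂ n₃ nz) (r : ℝ → Signal a b n₁ n₂ n₃ nz),
      (hG.transportPIE (τ j)).IsSolution q ψ₀ ψ r ↔
        G.IsTransportSolution (τ j) q (hG.Tbar ψ₀ + Tq (q 0))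
          (fun t => hG.Tbar (ψ t) + Tq (q t)) r := by
  have hq' : ∀ t, 0 ≤ t → q t = signal (qu t, qz t) := hq
  have hrec : ∀ t, 0 ≤ t → signal (recover (q t)) = q t := fun t ht => by
    rw [hq' t ht, recover_signal hab]
  refine ⟨⟨hG.lift (recover (q 0), ψ₀), ?_, ?_⟩, fun ψ r =>
    ⟨hG.isTransportSolution_of_isSolution (τ j) hrec hq₀,
      hG.isSolution_of_isTransportSolution (τ j) hrec⟩⟩
  · have h := hG.lift_mem_Y (p := recover (q 0)) (by rw [hrec 0 le_rfl, hq₀]) ψ₀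
    rwa [hrec 0 le_rfl] at h
  · rw [hG.toL2_lift, hrec 0 le_rfl]
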